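/- Let $N\ge 1$, $s\in(0,1)$, $p\in(1,\infty)$, and let $\Omega\subset\mathbb R^N$ be a bounded open set with Lipschitz boundary. Put $\rho(x)=\operatorname{dist}(x,\partial\Omega)$, and $p_s^\ast=\frac{Np}{N-sp}$ if $sp<N$, $p_s^\ast=\infty$ if $sp\ge N$ (with $1/\infty=0$). Let $|\cdot|_\tau$ denote the norm of $L^\tau(\Omega)$. Let $W_0^{s,p}(\Omega)$ be the space of all $u\in L^p(\mathbb R^N)$ with $$\|u\|:=\left(\int_{\mathbb R^{2N}}\frac{|u(x)-u(y)|^p}{|x-y|^{N+sp}}\,dx\,dy\right)^{1/p}<\infty$$ and $u=0$ a.e. in $\mathbb R^N\setminus\Omega$. Let $f:\Omega\times\mathbb R\to\mathbb R$ be a Carathéodory function such that, for some $m\ge1$, $$|f(x,t)|\le\sum_{i=1}^m h_i(x)|t|^{q_i-1}\quad\text{for a.e. }x\in\Omega\text{ and all }t\in\mathbb R,$$ where $q_i\in[1,p_s^\ast)$ and the $h_i$ are nonnegative measurable functions on $\Omega$ of class $\widetilde{\mathscr W}_{q_i}$, that is, $h_i\rho^{sa_i}\in L^{r_i}(\Omega)$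 for some $a_i\in[0,1]$ and $r_i\in(1,\infty)$ with $$\frac1{r_i}+\frac{a_i}{p}+\frac{\max\{p,q_i\}-a_i}{p_s^\ast}<1 .$$ For any such choice of $a_i,r_i$, let $\widetilde q:=\max_{1\le i\le m}\widetilde q_i$, where $\widetilde q_i\in(1,p_s^\ast)$ satisfies $$\frac1{r_i}+\frac{a_i}{p}+\frac{\max\{p,q_i\}-a_i}{\widetilde q_i}=1\qquad(i=1,\dots,m).$$ Then there exist positive constants $C,\gamma_1,\gamma_2$ such that every weak solution $u$ of $$(-\Delta)_p^su=f(x,u)\ \text{ in }\Omega,\qquad u=0\ \text{ in }\mathbb R^N\setminus\Omega,$$ is essentially bounded and satisfies $$|u|_\infty\le C\max\left\{|u|_{\widetilde q}^{\gamma_1},|u|_{\widetilde q}^{\gamma_2}\right\}.$$ Here a weak solution is a function $u\in W_0^{s,p}(\Omega)$ such that $f(\cdot,u)$ belongs to the dual space of $W_0^{s,p}(\Omega)$ (i.e. $f(\cdot,u)v\in L^1(\Omega)$ for all $v\in W_0^{s,p}(\Omega)$ and $v\mapsto\int_\Omega f(x,u)v\,dx$ is bounded with respect to $\|\cdot\|$)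 and $$\int_{\mathbb R^{2N}}\frac{|u(x)-u(y)|^{p-2}(u(x)-u(y))(v(x)-v(y))}{|x-y|^{N+sp}}\,dx\,dy=\int_\Omega f(x,u)\,v\,dx\qquad\forall v\in W_0^{s,p}(\Omega).$$ -/

import Mathlib

open MeasureTheory
open scoped ENNReal NNReal

noncomputable section

/-- The fractional critical Sobolev exponent: `N p / (N - s p)` if `s p < N`, and `∞` otherwise. -/
def criticalExponent (N : ℕ) (s p : ℝ) : ℝ≥0∞ :=
  if s * p < N then ENNReal.ofReal (N * p / (N - s * p)) else ⊤

/-- `Ω` has Lipschitz boundary: near each boundary point, in suitable orthonormal coordinates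
with last coordinate direction `e`, the set `Ω` is the part lying strictly above the graph of a
Lipschitz function of the component orthogonal to `e` (only the values of `φ` on the hyperplane
orthogonal to `e` matter). -/
def HasLipschitzBoundary {N : ℕ} (Ω : Set (EuclideanSpace ℝ (Fin N))) : Prop :=
  ∀ z ∈ frontier Ω, ∃ (e : EuclideanSpace ℝ (Fin N)) (K : ℝ≥0)
    (φ : EuclideanSpace ℝ (Fin N) → ℝ) (δ : ℝ),
    ‖e‖ = 1 ∧ LipschitzWith K φ ∧ 0 < δ ∧
      ∀ x ∈ Metric.ball z δ, (x ∈ Ω ↔ φ (x - inner ℝ x e • e) < inner ℝ x e)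

/-- The distance from `x` to the boundary of `Ω`. -/
def boundaryDist {N : ℕ} (Ω : Set (EuclideanSpace ℝ (Fin N)))
    (x : EuclideanSpace ℝ (Fin N)) : ℝ :=
  Metric.infDist x (frontier Ω)

/-- The Gagliardo energy
`∬ |u(x) - u(y)|^p / |x - y|^(N + s p) dx dy` over `ℝ^N × ℝ^N`, possibly infinite. -/
def gagliardoEnergy {N : ℕ} (s p : ℝ) (u : EuclideanSpace ℝ (Fin N) → ℝ) : ℝ≥0∞ :=
  ∫⁻ z : EuclideanSpace ℝ (Fin N) × EuclideanSpace ℝ (Fin N),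
    ENNReal.ofReal (|u z.1 - u z.2| ^ p / ‖z.1 - z.2‖ ^ (N + s * p))

/-- The Gagliardo norm, the `p`-th root of the energy. -/
def gagliardoNorm {N : ℕ} (s p : ℝ) (u : EuclideanSpace ℝ (Fin N) → ℝ) : ℝ :=
  (gagliardoEnergy s p u).toReal ^ (1 / p)

/-- Membership in `W_0^{s,p}(Ω)`: `u` belongs to `W^{s,p}(ℝ^N)` (that is, `u ∈ L^p(ℝ^N)` with
finite Gagliardo energy) and `u = 0` almost everywhere outside `Ω`. -/
structure MemSobolevZero {N : ℕ} (s p : ℝ) (Ω : Set (EuclideanSpace ℝ (Fin N)))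
    (u : EuclideanSpace ℝ (Fin N) → ℝ) : Prop where
  memLp : MemLp u (ENNReal.ofReal p) volume
  energy_lt_top : gagliardoEnergy s p u < ⊤
  zero_outside : ∀ᵐ x ∂volume, x ∉ Ω → u x = 0

/-- The weak form `⟨A(u), v⟩` of the fractional `p`-Laplacian. -/
def fracPLaplaceForm {N : ℕ} (s p : ℝ) (u v : EuclideanSpace ℝ (Fin N) → ℝ) : ℝ :=
  ∫ z : EuclideanSpace ℝ (Fin N) × EuclideanSpace ℝ (Fin N),
    |u z.1 - u z.2| ^ (p - 2) * (u z.1 - u z.2) * (v z.1 - v z.2) /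
      ‖z.1 - z.2‖ ^ (N + s * p)

/-- `u` is a weak solution of `(-Δ)_p^s u = f(x,u)` in `Ω`, `u = 0` outside `Ω`. The field `dual`
says that `f(·,u)` belongs to the dual space of `W_0^{s,p}(Ω)`, through `v ↦ ∫_Ω f(x,u) v dx`. -/
structure IsWeakSolution {N : ℕ} (s p : ℝ) (Ω : Set (EuclideanSpace ℝ (Fin N)))
    (f : EuclideanSpace ℝ (Fin N) → ℝ → ℝ) (u : EuclideanSpace ℝ (Fin N) → ℝ) : Prop where
  mem : MemSobolevZero s p Ω u
  dual : ∃ K : ℝ, ∀ v, MemSobolevZero s p Ω v →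
    IntegrableOn (fun x => f x (u x) * v x) Ω volume ∧
      |∫ x in Ω, f x (u x) * v x| ≤ K * gagliardoNorm s p v
  eq : ∀ v, MemSobolevZero s p Ω v →
    fracPLaplaceForm s p u v = ∫ x in Ω, f x (u x) * v x

/-- `f : Ω × ℝ → ℝ` is a Carathéodory function. -/
structure IsCaratheodory {N : ℕ} (Ω : Set (EuclideanSpace ℝ (Fin N)))
    (f : EuclideanSpace ℝ (Fin N) → ℝ → ℝ) : Prop where
  measurable : ∀ t : ℝ, AEMeasurable (fun x => f x t) (volume.restrict Ω)
  continuous : ∀ᵐ x ∂volume.restrict Ω, Continuous (f x)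

/-- The numbers `a` and `r` witness that `h` belongs to the weight class `W̃_q`: `h` is measurable
on `Ω`, `h ρ^(s a) ∈ L^r(Ω)` with `a ∈ [0,1]`, `r ∈ (1,∞)`, and
`1/r + a/p + (max{p,q} - a)/p_s^* < 1` (where `1/∞ = 0`). -/
structure IsTildeWeight {N : ℕ} (s p : ℝ) (Ω : Set (EuclideanSpace ℝ (Fin N)))
    (q a r : ℝ) (h : EuclideanSpace ℝ (Fin N) → ℝ) : Prop where
  aemeasurable : AEMeasurable h (volume.restrict Ω)
  a_nonneg : 0 ≤ a
  a_le_one : a ≤ 1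
  one_lt_r : 1 < r
  memLp : MemLp (fun x => h x * boundaryDist Ω x ^ (s * a)) (ENNReal.ofReal r)
    (volume.restrict Ω)
  exponents : 1 / r + a / p + (max p q - a) * ((criticalExponent N s p)⁻¹).toReal < 1

end

/-!
The proof is a De Giorgi iteration for the excesses `(u - l)^+` over levels `l ≥ 0`.

Testing the equation with `(u - l)^+` bounds the Gagliardo energy of the excess by
`∑ i, ∫_Ω h i |u|^(q i - 1) (u - l)^+` (`IsWeakSolution.gagliardoEnergy_excess_le`). If `k < l`, then
on `{u > l}` both `u` and `(u - l)^+` are controlled by `(u - k)^+`. The relation defining the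
exponents `qt i` is exactly what Hölder's inequality needs to split the `i`-th term into the norm of
`h i ρ^(s a i)`, the power `a i` of the Hardy quotient `(u - l)^+ / ρ^s` in `L^p`, and a power of
`(u - k)^+` in `L^qmax` (`exists_lintegral_weight_mul_excess_le`). As `a i ≤ 1 < p`, the energy on the
right is absorbed. The Sobolev inequality with an exponent `κ` strictly between `qmax` and the
critical one, and Chebyshev's inequality for the measure of `{u > l}` (`eLpNorm_excess_le`), then give
a superlinear recursion for the norms of the excesses in `L^qmax` (`exists_level_estimate`). For the
levels `M (1 - 2^(-n))` these norms tend to `0` geometrically provided finitely many inequalities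
`A |u|_qmax^(e i) ≤ M^(b i)` hold (`ae_le_of_level_estimate`), and this is the case once `M` is a
large multiple of `max {|u|_qmax^γ₁, |u|_qmax^γ₂}` (`exists_threshold`). The same applied to `-u`
bounds `u` from below.

Both functional inequalities come from pointwise lower bounds for the energy density
`∫ |w(x) - w(y)|^p / |x - y|^(N + s p) dy`. For Hardy's inequality (`exists_hardy_inequality`), the
Lipschitz condition provides, at distance about `ρ(x)` from `x`, a ball of radius about `ρ(x)` outside
`Ω`, where `w = 0`. For the Sobolev inequality, `|w|` is at most `|w(x)|/2` on half of a ball about `x`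
whose size Chebyshev's inequality dictates; this improves an `L^q` bound to an `L^(p + (s p / N) q)`
bound (`HasSobolevBound.step`), and iterating from `q = p` reaches every subcritical exponent.
-/

/-! ### Exterior balls of Lipschitz domains -/

/-- The complement of an open set with Lipschitz boundary contains, near each boundary point, a
cone with vertex there; so it contains a ball of radius comparable to `t` at distance `t`. The
constants are uniform because the boundary is compact. -/
lemma exists_ball_subset_compl_of_mem_frontier {N : ℕ} {Ω : Set (EuclideanSpace ℝ (Fin N))}
    (hΩo : IsOpen Ω) (hΩb : Bornology.IsBounded Ω) (hΩL : HasLipschitzBoundary Ω) :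
    ∃ c δ : ℝ, 0 < c ∧ c ≤ 1 ∧ 0 < δ ∧ ∀ z ∈ frontier Ω, ∀ t, 0 < t → t ≤ δ →
      ∃ y, dist y z ≤ t ∧ Metric.ball y (c * t) ⊆ Ωᶜ := by
  have hcomp : IsCompact (frontier Ω) :=
    (hΩb.isCompact_closure).of_isClosed_subset isClosed_frontier frontier_subset_closure
  suffices H : ∃ c δ : ℝ, 0 < c ∧ c ≤ 1 ∧ 0 < δ ∧ ∀ z ∈ frontier Ω, z ∈ frontier Ω →
      ∀ t, 0 < t → t ≤ δ → ∃ y, dist y z ≤ t ∧ Metric.ball y (c * t) ⊆ Ωᶜ by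
    obtain ⟨c, δ, hc, hc1, hδ, H⟩ := H
    exact ⟨c, δ, hc, hc1, hδ, fun z hz => H z hz hz⟩
  refine hcomp.induction_on (p := fun S => ∃ c δ : ℝ, 0 < c ∧ c ≤ 1 ∧ 0 < δ ∧ ∀ z ∈ S,
      z ∈ frontier Ω → ∀ t, 0 < t → t ≤ δ →
      ∃ y, dist y z ≤ t ∧ Metric.ball y (c * t) ⊆ Ωᶜ) ?_ ?_ ?_ ?_
  · exact ⟨1, 1, one_pos, le_rfl, one_pos, by simp⟩
  · rintro S T hST ⟨c, δ, hc, hc1, hδ, H⟩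
    exact ⟨c, δ, hc, hc1, hδ, fun z hz => H z (hST hz)⟩
  · rintro S T ⟨c, δ, hc, hc1, hδ, H⟩ ⟨c', δ', hc', hc1', hδ', H'⟩
    refine ⟨min c c', min δ δ', lt_min hc hc', (min_le_left _ _).trans hc1, lt_min hδ hδ', ?_⟩
    rintro z (hz | hz) hzf t ht0 ht
    · obtain ⟨y, hy, hb⟩ := H z hz hzf t ht0 (ht.trans (min_le_left _ _))
      exact ⟨y, hy, (Metric.ball_subset_ball (by gcongr; exact min_le_left _ _)).trans hb⟩
    · obtain ⟨y, hy, hb⟩ := H' z hz hzf t ht0 (ht.trans (min_le_right _ _))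
      exact ⟨y, hy, (Metric.ball_subset_ball (by gcongr; exact min_le_right _ _)).trans hb⟩
  · intro z₀ hz₀
    obtain ⟨e, K, φ, δ, he, hφ, hδ, hgraph⟩ := hΩL z₀ hz₀
    refine ⟨Metric.ball z₀ (δ / 2),
      mem_nhdsWithin_of_mem_nhds (Metric.ball_mem_nhds _ (by positivity)),
      1 / (1 + K), δ / 4, by positivity, ?_, by positivity, ?_⟩
    · rw [div_le_one (by positivity)]; simp
    intro z hz hzf t ht0 ht
    have hee : inner ℝ e e = (1 : ℝ) := by rw [real_inner_self_eq_norm_sq, he]; norm_num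
    refine ⟨z - t • e, ?_, ?_⟩
    · rw [dist_eq_norm, sub_sub_cancel_left, norm_neg, norm_smul, he, Real.norm_eq_abs,
        abs_of_pos ht0, mul_one]
    intro x hx hxΩ
    set v := x - (z - t • e) with hv
    have hvn : ‖v‖ < 1 / (1 + K) * t := by simpa [dist_eq_norm] using hx
    have hv1 : ‖v‖ * (1 + K) < t := by
      rw [div_mul_eq_mul_div, one_mul, lt_div_iff₀ (by positivity)] at hvn; exact hvn
    have hvt : ‖v‖ ≤ t := by nlinarith [norm_nonneg v, K.2, mul_nonneg (norm_nonneg v) K.2]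
    have hxe : x - z = v - t • e := by rw [hv]; abel
    have hxball : x ∈ Metric.ball z₀ δ := by
      have h1 : dist x z ≤ 2 * t := by
        rw [dist_eq_norm, hxe]
        calc ‖v - t • e‖ ≤ ‖v‖ + ‖t • e‖ := norm_sub_le _ _
          _ ≤ 2 * t := by rw [norm_smul, he, Real.norm_eq_abs, abs_of_pos ht0]; linarith
      have h2 : dist z z₀ < δ / 2 := hz
      have := dist_triangle x z z₀
      simp only [Metric.mem_ball]; linarith
    have hzball : z ∈ Metric.ball z₀ δ :=
      Metric.ball_subset_ball (by linarith) hz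
    have hzΩ : z ∉ Ω := by
      rw [hΩo.frontier_eq] at hzf; exact hzf.2
    have h1 := (hgraph x hxball).1 hxΩ
    have h2 : inner ℝ z e ≤ φ (z - inner ℝ z e • e) := by
      by_contra hcon; exact hzΩ ((hgraph z hzball).2 (not_le.1 hcon))
    have h3 := hφ.dist_le_mul (z - inner ℝ z e • e) (x - inner ℝ x e • e)
    have h4 : x = z + v - t • e := by rw [hv]; abel
    have hin : inner ℝ x e = inner ℝ z e + inner ℝ v e - t := by
      rw [h4, inner_sub_left, inner_add_left, inner_smul_left, hee]; simp
    have hsub : (z - inner ℝ z e • e) - (x - inner ℝ x e • e) = -(v - inner ℝ v e • e) := by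
      rw [hin, sub_smul, add_smul, h4]; module
    -- the component of `v` orthogonal to `e` is no longer than `v`
    have horth : ‖v - inner ℝ v e • e‖ ≤ ‖v‖ := by
      have : ‖v - inner ℝ v e • e‖ ^ 2 = ‖v‖ ^ 2 - (inner ℝ v e) ^ 2 := by
        rw [norm_sub_sq_real, inner_smul_right, norm_smul, he]
        simp only [Real.norm_eq_abs, mul_one, sq_abs]; ring
      exact abs_le_of_sq_le_sq' (by nlinarith [sq_nonneg (inner ℝ v e)]) (norm_nonneg _) |>.2
    rw [Real.dist_eq, dist_eq_norm, hsub, norm_neg] at h3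
    have h5 := (abs_le.1 h3).2
    have h6 : (K : ℝ) * ‖v - inner ℝ v e • e‖ ≤ K * ‖v‖ := by gcongr
    have h7 : inner ℝ v e ≤ ‖v‖ := by
      have := real_inner_le_norm v e; rwa [he, mul_one] at this
    linarith

/-- A point of a bounded open set is at a positive, attained distance from the boundary. -/
lemma exists_mem_frontier_boundaryDist_eq {N : ℕ} (hN : 1 ≤ N)
    {Ω : Set (EuclideanSpace ℝ (Fin N))} (hΩo : IsOpen Ω) (hΩb : Bornology.IsBounded Ω)
    {x : EuclideanSpace ℝ (Fin N)} (hx : x ∈ Ω) :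
    0 < boundaryDist Ω x ∧ ∃ z ∈ frontier Ω, boundaryDist Ω x = dist x z := by
  have hne : (frontier Ω).Nonempty := by
    rw [Set.nonempty_iff_ne_empty]
    intro hemp
    have hclopen := isClopen_iff_frontier_eq_empty.2 hemp
    rcases isClopen_iff.1 hclopen with h | h
    · simp [h] at hx
    · have : Nonempty (Fin N) := ⟨⟨0, hN⟩⟩
      rw [h] at hΩb
      exact NormedSpace.unbounded_univ ℝ (EuclideanSpace ℝ (Fin N)) hΩb
  refine ⟨(isClosed_frontier.notMem_iff_infDist_pos hne).1 ?_,
    isClosed_frontier.exists_infDist_eq_dist hne x⟩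
  rw [hΩo.frontier_eq]; exact fun h => h.2 hx

/-- The distance to the boundary is bounded on a bounded open set. -/
lemma exists_boundaryDist_le {N : ℕ} (hN : 1 ≤ N) {Ω : Set (EuclideanSpace ℝ (Fin N))}
    (hΩo : IsOpen Ω) (hΩb : Bornology.IsBounded Ω) :
    ∃ D : ℝ, 0 < D ∧ ∀ x ∈ Ω, boundaryDist Ω x ≤ D := by
  obtain ⟨D, hD⟩ := (Metric.isBounded_iff.1 hΩb.closure)
  refine ⟨max D 1, by positivity, fun x hx => ?_⟩
  obtain ⟨-, z, hz, hxz⟩ := exists_mem_frontier_boundaryDist_eq hN hΩo hΩb hx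
  rw [hxz]
  exact (hD (subset_closure hx) (frontier_subset_closure hz)).trans (le_max_left _ _)

/-- Around a point `x` of a bounded Lipschitz domain there is, at the scale of the distance `ρ(x)`
to the boundary, a ball outside the domain. -/
lemma exists_ball_subset_compl_of_mem {N : ℕ} (hN : 1 ≤ N) {Ω : Set (EuclideanSpace ℝ (Fin N))}
    (hΩo : IsOpen Ω) (hΩb : Bornology.IsBounded Ω) (hΩL : HasLipschitzBoundary Ω) :
    ∃ c : ℝ, 0 < c ∧ ∀ x ∈ Ω, ∃ y, Metric.ball y (c * boundaryDist Ω x) ⊆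
      Ωᶜ ∩ Metric.closedBall x (3 * boundaryDist Ω x) := by
  obtain ⟨c, δ, hc, hc1, hδ, H⟩ := exists_ball_subset_compl_of_mem_frontier hΩo hΩb hΩL
  obtain ⟨D, hD, hDle⟩ := exists_boundaryDist_le hN hΩo hΩb
  set l := min 1 (δ / D) with hl
  have hl0 : 0 < l := by positivity
  refine ⟨c * l, by positivity, fun x hx => ?_⟩
  obtain ⟨hρ, z, hz, hxz⟩ := exists_mem_frontier_boundaryDist_eq hN hΩo hΩb hx
  set d := boundaryDist Ω x
  have hld : l * d ≤ δ := by
    calc l * d ≤ δ / D * D := by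
          gcongr
          · exact min_le_right _ _
          · exact hDle x hx
      _ = δ := by field_simp
  have hld' : l * d ≤ d := mul_le_of_le_one_left hρ.le (min_le_left _ _)
  obtain ⟨y, hyz, hy⟩ := H z hz (l * d) (by positivity) hld
  refine ⟨y, fun w hw => ⟨hy (by rwa [← mul_assoc]), ?_⟩⟩
  have h1 : dist w y < c * (l * d) := by rw [← mul_assoc]; exact hw
  have h2 : c * (l * d) ≤ d := (mul_le_of_le_one_left (by positivity) hc1).trans hld'
  have h3 : dist w x ≤ dist w y + dist y z + dist z x := dist_triangle4 _ _ _ _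
  rw [dist_comm z x, ← hxz] at h3
  simp only [Metric.mem_closedBall]; linarith

/-! ### Pointwise lower bounds for the Gagliardo energy density -/

/-- The inner integral of the Gagliardo energy,
`x ↦ ∫ |u(x) - u(y)|^p / |x - y|^(N + s p) dy`. -/
noncomputable def gagliardoDensity {N : ℕ} (s p : ℝ) (u : EuclideanSpace ℝ (Fin N) → ℝ)
    (x : EuclideanSpace ℝ (Fin N)) : ℝ≥0∞ :=
  ∫⁻ y, ENNReal.ofReal (|u x - u y| ^ p / ‖x - y‖ ^ (N + s * p))

lemma aemeasurable_gagliardo_integrand {N : ℕ} (s p : ℝ) {u : EuclideanSpace ℝ (Fin N) → ℝ}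
    (hu : AEMeasurable u) :
    AEMeasurable (fun z : EuclideanSpace ℝ (Fin N) × EuclideanSpace ℝ (Fin N) =>
      ENNReal.ofReal (|u z.1 - u z.2| ^ p / ‖z.1 - z.2‖ ^ (N + s * p))) volume := by
  have h1 : AEMeasurable (fun z : EuclideanSpace ℝ (Fin N) × EuclideanSpace ℝ (Fin N) => u z.1)
      volume := hu.comp_fst
  have h2 : AEMeasurable (fun z : EuclideanSpace ℝ (Fin N) × EuclideanSpace ℝ (Fin N) => u z.2)
      volume := hu.comp_snd
  fun_prop

lemma lintegral_gagliardoDensity {N : ℕ} (s p : ℝ) {u : EuclideanSpace ℝ (Fin N) → ℝ}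
    (hu : AEMeasurable u) : ∫⁻ x, gagliardoDensity s p u x = gagliardoEnergy s p u := by
  rw [gagliardoEnergy, Measure.volume_eq_prod,
    lintegral_prod _ (aemeasurable_gagliardo_integrand s p hu)]
  rfl

/-- Oscillation of size `A` on a set `B` within distance `R` of `x` makes the energy density at
`x` large. -/
lemma ofReal_mul_volume_le_gagliardoDensity {N : ℕ} {s p : ℝ} (hs : 0 < s) (hp : 0 < p)
    {u : EuclideanSpace ℝ (Fin N) → ℝ} (hu : AEMeasurable u) {x : EuclideanSpace ℝ (Fin N)}
    {B : Set (EuclideanSpace ℝ (Fin N))} {A R : ℝ} (hA : 0 < A)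
    (hB : ∀ᵐ y, y ∈ B → A ≤ |u x - u y| ∧ ‖x - y‖ ≤ R) :
    ENNReal.ofReal (A ^ p / R ^ (N + s * p)) * volume B ≤ gagliardoDensity s p u x := by
  have hm : AEMeasurable (fun y => ENNReal.ofReal (|u x - u y| ^ p / ‖x - y‖ ^ (N + s * p)))
      volume := by fun_prop
  refine le_trans ?_ (mul_meas_ge_le_lintegral₀ hm (ENNReal.ofReal (A ^ p / R ^ (N + s * p))))
  refine mul_le_mul_right (measure_mono_ae (μ := volume) ?_) _
  filter_upwards [hB] with y hy hyB
  obtain ⟨h1, h2⟩ := hy hyB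
  have hxy : 0 < ‖x - y‖ := by
    rw [norm_pos_iff, sub_ne_zero]
    rintro rfl
    simp at h1; linarith
  show ENNReal.ofReal _ ≤ _
  gcongr

/-- The volume of the unit ball. -/
noncomputable def unitBallVolume (N : ℕ) : ℝ :=
  (volume (Metric.ball (0 : EuclideanSpace ℝ (Fin N)) 1)).toReal

lemma unitBallVolume_pos (N : ℕ) : 0 < unitBallVolume N :=
  ENNReal.toReal_pos (Metric.measure_ball_pos _ _ one_pos).ne' measure_ball_lt_top.ne

lemma volume_ball_eq_ofReal {N : ℕ} (x : EuclideanSpace ℝ (Fin N)) {r : ℝ} (hr : 0 < r) :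
    volume (Metric.ball x r) = ENNReal.ofReal (r ^ N * unitBallVolume N) := by
  rw [Measure.addHaar_ball_of_pos _ _ hr, ENNReal.ofReal_mul (by positivity), unitBallVolume,
    ENNReal.ofReal_toReal measure_ball_lt_top.ne, finrank_euclideanSpace_fin]

/-! ### The fractional Hardy inequality -/

/-- The fractional Hardy inequality on bounded Lipschitz domains. As functions of `W_0^{s,p}` vanish
outside `Ω`, the exterior ball at distance about `ρ(x)` from `x` already contributes
`|w(x)|^p / ρ(x)^(s p)` to the energy density. -/
lemma exists_hardy_inequality {N : ℕ} (hN : 1 ≤ N) {s p : ℝ} (hs : 0 < s) (hp : 1 < p)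
    {Ω : Set (EuclideanSpace ℝ (Fin N))} (hΩo : IsOpen Ω) (hΩb : Bornology.IsBounded Ω)
    (hΩL : HasLipschitzBoundary Ω) :
    ∃ C : ℝ, 0 < C ∧ ∀ w, MemSobolevZero s p Ω w →
      ∫⁻ x in Ω, ENNReal.ofReal ((|w x| / boundaryDist Ω x ^ s) ^ p) ≤
        ENNReal.ofReal C * gagliardoEnergy s p w := by
  obtain ⟨c, hc, H⟩ := exists_ball_subset_compl_of_mem hN hΩo hΩb hΩL
  set C : ℝ := c ^ N * unitBallVolume N / 3 ^ (N + s * p) with hC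
  have hC0 : 0 < C := by have := unitBallVolume_pos N; positivity
  refine ⟨C⁻¹, by positivity, fun w hw => ?_⟩
  have hwm : AEMeasurable w := hw.memLp.1.aemeasurable
  have key : ∀ x ∈ Ω, ENNReal.ofReal ((|w x| / boundaryDist Ω x ^ s) ^ p) ≤
      ENNReal.ofReal C⁻¹ * gagliardoDensity s p w x := by
    intro x hx
    obtain ⟨hρ, -⟩ := exists_mem_frontier_boundaryDist_eq hN hΩo hΩb hx
    obtain ⟨y, hy⟩ := H x hx
    set d := boundaryDist Ω x with hd
    rcases eq_or_ne (w x) 0 with h0 | h0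
    · simp [h0, Real.zero_rpow (by linarith : p ≠ 0)]
    have hA : 0 < |w x| := abs_pos.2 h0
    have h1 := ofReal_mul_volume_le_gagliardoDensity hs (by linarith : 0 < p) hwm (x := x)
      (B := Metric.ball y (c * d)) (R := 3 * d) hA (by
        filter_upwards [hw.zero_outside] with z hz hzB
        refine ⟨by rw [hz (hy hzB).1, sub_zero], ?_⟩
        rw [← dist_eq_norm, dist_comm]; exact (hy hzB).2)
    rw [volume_ball_eq_ofReal _ (by positivity), ← ENNReal.ofReal_mul (by positivity)] at h1
    refine le_trans (le_of_eq ?_) (mul_le_mul_right h1 (ENNReal.ofReal C⁻¹))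
    rw [← ENNReal.ofReal_mul (by positivity)]
    congr 1
    rw [hC, Real.div_rpow hA.le (by positivity), Real.mul_rpow (by norm_num) hρ.le,
      ← Real.rpow_mul hρ.le, Real.rpow_add hρ, Real.rpow_natCast, mul_pow]
    have := unitBallVolume_pos N
    field_simp
  calc ∫⁻ x in Ω, ENNReal.ofReal ((|w x| / boundaryDist Ω x ^ s) ^ p)
      ≤ ∫⁻ x in Ω, ENNReal.ofReal C⁻¹ * gagliardoDensity s p w x :=
        setLIntegral_mono' hΩo.measurableSet key
    _ ≤ ∫⁻ x, ENNReal.ofReal C⁻¹ * gagliardoDensity s p w x := setLIntegral_le_lintegral _ _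
    _ = _ := by
      rw [lintegral_const_mul' _ _ ENNReal.ofReal_ne_top, lintegral_gagliardoDensity s p hwm]

/-! ### Subcritical fractional Sobolev inequalities -/

/-- One step of the Sobolev bootstrap, in pointwise form. Chebyshev's inequality bounds the measure
of `{|u| ≥ |u(x)|/2}` by `J (2/|u(x)|)^q`; on at least half of the ball about `x` of twice that
volume, `u` then differs from `u(x)` by `|u(x)|/2`. -/
lemma exists_pointwise_sobolev {N : ℕ} (hN : 1 ≤ N) {s p q : ℝ} (hs : 0 < s) (hp : 1 < p)
    (hq : 0 < q) :
    ∃ C : ℝ, 0 < C ∧ ∀ (u : EuclideanSpace ℝ (Fin N) → ℝ) (J : ℝ), AEMeasurable u → 0 < J →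
      ∫⁻ x, ENNReal.ofReal (|u x| ^ q) ≤ ENNReal.ofReal J → ∀ x,
        ENNReal.ofReal (|u x| ^ (p + s * p / N * q)) ≤
          ENNReal.ofReal (C * J ^ (s * p / N)) * gagliardoDensity s p u x := by
  have hω := unitBallVolume_pos N
  set ω := unitBallVolume N
  have hN0 : (0 : ℝ) < N := by exact_mod_cast hN
  set K : ℝ := (ω / 2) * 2⁻¹ ^ p / (2 * 2 ^ q / ω) ^ (s * p / N) with hK
  have hK0 : 0 < K := by positivity
  refine ⟨K⁻¹, by positivity, fun u J hu hJ hI x => ?_⟩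
  rcases eq_or_ne (u x) 0 with h0 | h0
  · rw [h0, abs_zero, Real.zero_rpow (by positivity)]; simp
  have hT : 0 < |u x| := abs_pos.2 h0
  set T := |u x| with hTdef
  set E : Set (EuclideanSpace ℝ (Fin N)) :=
    {y | ENNReal.ofReal ((T / 2) ^ q) ≤ ENNReal.ofReal (|u y| ^ q)} with hE
  have hEvol : volume E ≤ ENNReal.ofReal (J * (2 / T) ^ q) := by
    have h1 := mul_meas_ge_le_lintegral₀ (μ := volume)
      (f := fun y => ENNReal.ofReal (|u y| ^ q)) (by fun_prop) (ENNReal.ofReal ((T / 2) ^ q))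
    have h2 : ENNReal.ofReal ((T / 2) ^ q) ≠ 0 := by
      rw [Ne, ENNReal.ofReal_eq_zero, not_le]; positivity
    calc volume E ≤ ENNReal.ofReal J / ENNReal.ofReal ((T / 2) ^ q) := by
          rw [ENNReal.le_div_iff_mul_le (Or.inl h2) (Or.inl ENNReal.ofReal_ne_top), mul_comm]
          exact h1.trans hI
      _ = _ := by
        rw [← ENNReal.ofReal_div_of_pos (by positivity)]
        congr 1
        rw [div_eq_mul_inv, ← Real.inv_rpow (by positivity), inv_div]
  set V : ℝ := J * (2 / T) ^ q with hV
  have hV0 : 0 < V := by positivity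
  set r : ℝ := (2 * V / ω) ^ (1 / (N : ℝ)) with hr
  have hr0 : 0 < r := by positivity
  have hrN : r ^ N * ω = 2 * V := by
    rw [hr, ← Real.rpow_natCast, ← Real.rpow_mul (by positivity), one_div_mul_cancel hN0.ne',
      Real.rpow_one]; field_simp
  have hBvol : ENNReal.ofReal V ≤ volume (Metric.ball x r \ E) := by
    refine le_trans ?_ le_measure_sdiff
    rw [volume_ball_eq_ofReal _ hr0]
    calc ENNReal.ofReal V = ENNReal.ofReal (2 * V) - ENNReal.ofReal V := by
          rw [← ENNReal.ofReal_sub _ hV0.le]; congr 1; ring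
      _ ≤ _ := by rw [← hrN]; exact tsub_le_tsub_left hEvol _
  have h1 := ofReal_mul_volume_le_gagliardoDensity hs (by linarith : 0 < p) hu (x := x)
    (B := Metric.ball x r \ E) (R := r) (half_pos hT) (by
      refine Filter.Eventually.of_forall fun y hy => ⟨?_, ?_⟩
      · have hyE : |u y| < T / 2 := by
          by_contra hcon
          refine hy.2 (ENNReal.ofReal_le_ofReal ?_)
          have := not_lt.1 hcon
          gcongr
        have := abs_sub_abs_le_abs_sub (u x) (u y)
        linarith
      · rw [← dist_eq_norm, dist_comm]; exact (Metric.mem_ball.1 hy.1).le)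
  have h2 := (mul_le_mul_right hBvol (ENNReal.ofReal ((T / 2) ^ p / r ^ (N + s * p)))).trans h1
  rw [← ENNReal.ofReal_mul (by positivity)] at h2
  refine le_trans (le_of_eq ?_) (mul_le_mul_right h2 (ENNReal.ofReal (K⁻¹ * J ^ (s * p / N))))
  rw [← ENNReal.ofReal_mul (by positivity)]
  congr 1
  have hrs : r ^ (s * p) = (2 * 2 ^ q / ω) ^ (s * p / N) * J ^ (s * p / N) *
      (T ^ (s * p / N * q))⁻¹ := by
    have h3 : 2 * V / ω = (2 * 2 ^ q / ω) * J * (T ^ q)⁻¹ := by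
      rw [hV, Real.div_rpow (by norm_num) hT.le]; ring
    rw [hr, ← Real.rpow_mul (by positivity), one_div_mul_eq_div, h3,
      Real.mul_rpow (by positivity) (by positivity), Real.mul_rpow (by positivity) (by positivity),
      Real.inv_rpow (by positivity), ← Real.rpow_mul hT.le, mul_comm q]
  have hVr : V = ω / 2 * r ^ N := by linarith
  rw [Real.rpow_add hr0, Real.rpow_natCast, hVr, hrs, hK, Real.rpow_add hT, div_eq_mul_inv T 2,
    Real.mul_rpow hT.le (by norm_num)]
  field_simp

lemma gagliardoNorm_nonneg {N : ℕ} (s p : ℝ) (u : EuclideanSpace ℝ (Fin N) → ℝ) :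
    0 ≤ gagliardoNorm s p u := by
  unfold gagliardoNorm; positivity

lemma ofReal_gagliardoNorm_rpow {N : ℕ} {s p : ℝ} (hp : 1 < p)
    {u : EuclideanSpace ℝ (Fin N) → ℝ} (hu : gagliardoEnergy s p u < ⊤) :
    ENNReal.ofReal (gagliardoNorm s p u ^ p) = gagliardoEnergy s p u := by
  rw [gagliardoNorm, ← Real.rpow_mul ENNReal.toReal_nonneg, one_div_mul_cancel (by linarith),
    Real.rpow_one, ENNReal.ofReal_toReal hu.ne]

/-- The embedding `W_0^{s,p}(Ω) ⊆ L^q(ℝ^N)`, as a bound of `∫ |w|^q` by the `q`-th power of the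
Gagliardo norm alone. -/
def HasSobolevBound {N : ℕ} (s p : ℝ) (Ω : Set (EuclideanSpace ℝ (Fin N))) (q : ℝ) : Prop :=
  ∃ C : ℝ, 0 < C ∧ ∀ w, MemSobolevZero s p Ω w →
    ∫⁻ x, ENNReal.ofReal (|w x| ^ q) ≤ ENNReal.ofReal (C * gagliardoNorm s p w ^ q)

/-- Poincaré's inequality, from Hardy's because the distance to the boundary is bounded. -/
lemma hasSobolevBound_self {N : ℕ} (hN : 1 ≤ N) {s p : ℝ} (hs : 0 < s) (hp : 1 < p)
    {Ω : Set (EuclideanSpace ℝ (Fin N))} (hΩo : IsOpen Ω) (hΩb : Bornology.IsBounded Ω)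
    (hΩL : HasLipschitzBoundary Ω) : HasSobolevBound s p Ω p := by
  obtain ⟨C, hC, H⟩ := exists_hardy_inequality hN hs hp hΩo hΩb hΩL
  obtain ⟨D, hD, hDle⟩ := exists_boundaryDist_le hN hΩo hΩb
  refine ⟨(D ^ s) ^ p * C, by positivity, fun w hw => ?_⟩
  calc ∫⁻ x, ENNReal.ofReal (|w x| ^ p) = ∫⁻ x in Ω, ENNReal.ofReal (|w x| ^ p) := by
        rw [← lintegral_indicator hΩo.measurableSet]
        refine lintegral_congr_ae ?_
        filter_upwards [hw.zero_outside] with x hx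
        by_cases hxΩ : x ∈ Ω
        · simp [hxΩ]
        · simp [hxΩ, hx hxΩ, Real.zero_rpow (by linarith : p ≠ 0)]
    _ ≤ ∫⁻ x in Ω, ENNReal.ofReal ((D ^ s) ^ p) *
          ENNReal.ofReal ((|w x| / boundaryDist Ω x ^ s) ^ p) := by
        refine setLIntegral_mono' hΩo.measurableSet fun x hx => ?_
        obtain ⟨hρ, -⟩ := exists_mem_frontier_boundaryDist_eq hN hΩo hΩb hx
        rw [← ENNReal.ofReal_mul (by positivity), ← Real.mul_rpow (by positivity) (by positivity)]
        refine ENNReal.ofReal_le_ofReal (Real.rpow_le_rpow (by positivity) ?_ (by linarith))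
        rw [mul_div_assoc', le_div_iff₀ (by positivity), mul_comm]
        gcongr
        exact hDle x hx
    _ ≤ _ := by
        rw [lintegral_const_mul' _ _ ENNReal.ofReal_ne_top, mul_assoc,
          ENNReal.ofReal_mul (by positivity), ENNReal.ofReal_mul hC.le,
          ofReal_gagliardoNorm_rpow hp hw.energy_lt_top]
        gcongr
        exact H w hw

lemma HasSobolevBound.step {N : ℕ} (hN : 1 ≤ N) {s p q : ℝ} (hs : 0 < s) (hp : 1 < p) (hq : 0 < q)
    {Ω : Set (EuclideanSpace ℝ (Fin N))} (h : HasSobolevBound s p Ω q) :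
    HasSobolevBound s p Ω (p + s * p / N * q) := by
  obtain ⟨C₁, hC₁, h⟩ := h
  obtain ⟨C₂, hC₂, H⟩ := exists_pointwise_sobolev hN hs hp hq
  refine ⟨C₂ * C₁ ^ (s * p / N), by positivity, fun w hw => ?_⟩
  have hwm : AEMeasurable w := hw.memLp.1.aemeasurable
  have hθ : 0 ≤ s * p / N := by positivity
  have hI := h w hw
  rcases (gagliardoNorm_nonneg s p w).eq_or_lt with h0 | hn
  · -- if the energy vanishes, then `w = 0` a.e., and the bound is trivial
    rw [← h0, Real.zero_rpow hq.ne', mul_zero, ENNReal.ofReal_zero, nonpos_iff_eq_zero,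
      lintegral_eq_zero_iff' (by fun_prop)] at hI
    have : ∫⁻ x, ENNReal.ofReal (|w x| ^ (p + s * p / N * q)) = 0 := by
      rw [lintegral_eq_zero_iff' (by fun_prop)]
      filter_upwards [hI] with x hx
      have hx0 : |w x| = 0 := by
        by_contra hcon
        have h1 : 0 < |w x| := lt_of_le_of_ne (abs_nonneg _) (Ne.symm hcon)
        have h2 : ENNReal.ofReal (|w x| ^ q) = 0 := hx
        rw [ENNReal.ofReal_eq_zero] at h2
        linarith [Real.rpow_pos_of_pos h1 q]
      simp [hx0, Real.zero_rpow (by positivity : p + s * p / N * q ≠ 0)]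
    rw [this]; exact bot_le
  · have h1 := H w (C₁ * gagliardoNorm s p w ^ q) hwm (by positivity) hI
    calc ∫⁻ x, ENNReal.ofReal (|w x| ^ (p + s * p / N * q))
        ≤ ∫⁻ x, ENNReal.ofReal (C₂ * (C₁ * gagliardoNorm s p w ^ q) ^ (s * p / N)) *
            gagliardoDensity s p w x := lintegral_mono h1
      _ = ENNReal.ofReal (C₂ * (C₁ * gagliardoNorm s p w ^ q) ^ (s * p / N)) *
            ENNReal.ofReal (gagliardoNorm s p w ^ p) := by
          rw [lintegral_const_mul' _ _ ENNReal.ofReal_ne_top, lintegral_gagliardoDensity s p hwm,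
            ofReal_gagliardoNorm_rpow hp hw.energy_lt_top]
      _ = _ := by
          rw [← ENNReal.ofReal_mul (by positivity)]
          congr 1
          rw [Real.mul_rpow hC₁.le (by positivity), ← Real.rpow_mul hn.le, Real.rpow_add hn,
            mul_comm q]
          ring

lemma hasSobolevBound_geom_sum {N : ℕ} (hN : 1 ≤ N) {s p : ℝ} (hs : 0 < s) (hp : 1 < p)
    {Ω : Set (EuclideanSpace ℝ (Fin N))} (hΩo : IsOpen Ω) (hΩb : Bornology.IsBounded Ω)
    (hΩL : HasLipschitzBoundary Ω) (k : ℕ) :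
    HasSobolevBound s p Ω (p * ∑ j ∈ Finset.range (k + 1), (s * p / N) ^ j) := by
  induction k with
  | zero => simpa using hasSobolevBound_self hN hs hp hΩo hΩb hΩL
  | succ k ih =>
    have hpos : 0 < p * ∑ j ∈ Finset.range (k + 1), (s * p / N) ^ j := by
      rw [Finset.sum_range_succ']
      have : 0 ≤ ∑ j ∈ Finset.range k, (s * p / N) ^ (j + 1) :=
        Finset.sum_nonneg fun j _ => by positivity
      rw [pow_zero]; positivity
    have := ih.step hN hs hp hpos
    convert this using 1
    rw [Finset.sum_range_succ', mul_left_comm, Finset.mul_sum]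
    simp only [pow_succ']; ring

/-- The exponents `p (1 + θ + ⋯ + θ^k)`, `θ = s p / N`, reach every subcritical exponent. -/
lemma exists_lt_geom_sum {N : ℕ} (hN : 1 ≤ N) {s p κ : ℝ} (hs : 0 < s) (hp : 1 < p)
    (hκ : ENNReal.ofReal κ < criticalExponent N s p) :
    ∃ k, κ < p * ∑ j ∈ Finset.range (k + 1), (s * p / N) ^ j := by
  have hN0 : (0 : ℝ) < N := by exact_mod_cast hN
  unfold criticalExponent at hκ
  split_ifs at hκ with hsp
  · have hθ1 : s * p / N < 1 := by rwa [div_lt_one hN0]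
    have hlim := ((hasSum_geometric_of_lt_one (by positivity) hθ1).tendsto_sum_nat).const_mul p
    have hlim' := hlim.comp (Filter.tendsto_add_atTop_nat 1)
    have heq : p * (1 - s * p / N)⁻¹ = N * p / (N - s * p) := by
      have : (N : ℝ) - s * p ≠ 0 := by linarith
      field_simp
    rw [heq] at hlim'
    have hκ' : κ < N * p / (N - s * p) := by
      by_contra hcon
      exact absurd hκ (not_lt.2 (ENNReal.ofReal_le_ofReal (not_lt.1 hcon)))
    exact (hlim'.eventually (lt_mem_nhds hκ')).exists
  · have hθ1 : 1 ≤ s * p / N := by rw [le_div_iff₀ hN0]; linarith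
    obtain ⟨k, hk⟩ := exists_nat_gt κ
    refine ⟨k, hk.trans_le ?_⟩
    have h1 : ((k : ℝ) + 1) ≤ ∑ j ∈ Finset.range (k + 1), (s * p / N) ^ j := by
      have : ∑ j ∈ Finset.range (k + 1), (1 : ℝ) ≤ ∑ j ∈ Finset.range (k + 1), (s * p / N) ^ j :=
        Finset.sum_le_sum fun j _ => one_le_pow₀ hθ1
      simpa using this
    nlinarith

lemma eLpNorm_ofReal_eq {α : Type*} [MeasurableSpace α] {μ : Measure α} {q : ℝ} (hq : 0 < q)
    (u : α → ℝ) :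
    eLpNorm u (ENNReal.ofReal q) μ = (∫⁻ x, ENNReal.ofReal (|u x| ^ q) ∂μ) ^ (1 / q) := by
  rw [eLpNorm_eq_lintegral_rpow_enorm_toReal (by simpa using hq) ENNReal.ofReal_ne_top,
    ENNReal.toReal_ofReal hq.le]
  congr 2 with x
  rw [Real.enorm_eq_ofReal_abs, ENNReal.ofReal_rpow_of_nonneg (abs_nonneg _) hq.le]

lemma lintegral_ofReal_rpow_eq {α : Type*} [MeasurableSpace α] {μ : Measure α} {q : ℝ} (hq : 0 < q)
    (u : α → ℝ) :
    ∫⁻ x, ENNReal.ofReal (|u x| ^ q) ∂μ = eLpNorm u (ENNReal.ofReal q) μ ^ q := by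
  rw [eLpNorm_ofReal_eq hq, ← ENNReal.rpow_mul, one_div_mul_cancel hq.ne', ENNReal.rpow_one]

/-- Lowering the exponent of an `L^q` norm costs a power of the measure; a finite-measure form
with a real constant. -/
lemma exists_eLpNorm_le_mul_eLpNorm {α : Type*} [MeasurableSpace α] {μ : Measure α}
    [IsFiniteMeasure μ] {q κ : ℝ} (hq : 0 < q) (hqκ : q ≤ κ) :
    ∃ C : ℝ, 0 < C ∧ ∀ u : α → ℝ, AEStronglyMeasurable u μ →
      eLpNorm u (ENNReal.ofReal q) μ ≤ ENNReal.ofReal C * eLpNorm u (ENNReal.ofReal κ) μ := by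
  have hfin : μ Set.univ ^ (1 / q - 1 / κ) ≠ ⊤ :=
    ENNReal.rpow_ne_top_of_nonneg (sub_nonneg.2 (one_div_le_one_div_of_le hq hqκ))
      (measure_ne_top _ _)
  refine ⟨(μ Set.univ ^ (1 / q - 1 / κ)).toReal + 1, by positivity, fun u hu => ?_⟩
  have := eLpNorm_le_eLpNorm_mul_rpow_measure_univ (ENNReal.ofReal_le_ofReal hqκ) hu
  rw [ENNReal.toReal_ofReal hq.le, ENNReal.toReal_ofReal (hq.le.trans hqκ), mul_comm] at this
  refine this.trans ?_
  gcongr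
  calc _ = ENNReal.ofReal (μ Set.univ ^ (1 / q - 1 / κ)).toReal := (ENNReal.ofReal_toReal hfin).symm
    _ ≤ _ := ENNReal.ofReal_le_ofReal (by linarith)

/-- The subcritical Sobolev embedding of `W_0^{s,p}(Ω)`. -/
lemma exists_sobolev_inequality {N : ℕ} (hN : 1 ≤ N) {s p κ : ℝ} (hs : 0 < s) (hp : 1 < p)
    {Ω : Set (EuclideanSpace ℝ (Fin N))} (hΩo : IsOpen Ω) (hΩb : Bornology.IsBounded Ω)
    (hΩL : HasLipschitzBoundary Ω) (hκ0 : 0 < κ)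
    (hκ : ENNReal.ofReal κ < criticalExponent N s p) :
    ∃ C : ℝ, 0 < C ∧ ∀ w, MemSobolevZero s p Ω w →
      eLpNorm w (ENNReal.ofReal κ) (volume.restrict Ω) ≤
        ENNReal.ofReal (C * gagliardoNorm s p w) := by
  obtain ⟨k, hk⟩ := exists_lt_geom_sum hN hs hp hκ
  obtain ⟨C₁, hC₁, H₁⟩ := hasSobolevBound_geom_sum hN hs hp hΩo hΩb hΩL k
  set t := p * ∑ j ∈ Finset.range (k + 1), (s * p / N) ^ j
  have ht : 0 < t := hκ0.trans hk
  have : IsFiniteMeasure (volume.restrict Ω) := ⟨by simpa using hΩb.measure_lt_top⟩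
  obtain ⟨C₂, hC₂, H₂⟩ := exists_eLpNorm_le_mul_eLpNorm (μ := volume.restrict Ω) hκ0 hk.le
  refine ⟨C₂ * C₁ ^ (1 / t), by positivity, fun w hw => (H₂ w hw.memLp.1.restrict).trans ?_⟩
  have hn := gagliardoNorm_nonneg s p w
  rw [mul_assoc, ENNReal.ofReal_mul hC₂.le]
  gcongr
  calc eLpNorm w (ENNReal.ofReal t) (volume.restrict Ω)
      ≤ eLpNorm w (ENNReal.ofReal t) volume := eLpNorm_mono_measure _ Measure.restrict_le_self
    _ ≤ ENNReal.ofReal (C₁ * gagliardoNorm s p w ^ t) ^ (1 / t) := by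
        rw [eLpNorm_ofReal_eq ht]
        gcongr
        exact H₁ w hw
    _ = _ := by
        rw [ENNReal.ofReal_rpow_of_nonneg (by positivity) (by positivity),
          Real.mul_rpow hC₁.le (by positivity), ← Real.rpow_mul hn, mul_one_div_cancel ht.ne',
          Real.rpow_one]

/-! ### Testing the equation with truncations -/

/-- The excess `(u - l)^+` of `u` over the level `l`. -/
def excess {α : Type*} (u : α → ℝ) (l : ℝ) (x : α) : ℝ := max (u x - l) 0

lemma excess_nonneg {α : Type*} (u : α → ℝ) (l : ℝ) (x : α) : 0 ≤ excess u l x := le_max_right _ _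

lemma abs_excess_sub_excess_le {α : Type*} (u : α → ℝ) (l : ℝ) (x y : α) :
    |excess u l x - excess u l y| ≤ |u x - u y| := by
  have := abs_max_sub_max_le_abs (u x - l) (u y - l) 0
  rwa [sub_sub_sub_cancel_right] at this

lemma abs_excess_le {α : Type*} (u : α → ℝ) {l : ℝ} (hl : 0 ≤ l) (x : α) :
    |excess u l x| ≤ |u x| := by
  rw [abs_of_nonneg (excess_nonneg _ _ _)]
  exact max_le (by linarith [le_abs_self (u x)]) (abs_nonneg _)

lemma MemSobolevZero.excess {N : ℕ} {s p : ℝ} (hp : 1 < p) {Ω : Set (EuclideanSpace ℝ (Fin N))}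
    {u : EuclideanSpace ℝ (Fin N) → ℝ} (hu : MemSobolevZero s p Ω u) {l : ℝ} (hl : 0 ≤ l) :
    MemSobolevZero s p Ω (excess u l) where
  memLp := by
    refine hu.memLp.of_le ?_ (Filter.Eventually.of_forall (abs_excess_le u hl))
    have := hu.memLp.1.aemeasurable
    unfold _root_.excess
    exact AEMeasurable.aestronglyMeasurable (by fun_prop)
  energy_lt_top := by
    refine lt_of_le_of_lt (lintegral_mono fun z => ENNReal.ofReal_le_ofReal ?_) hu.energy_lt_top
    exact div_le_div_of_nonneg_right (Real.rpow_le_rpow (abs_nonneg _)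
      (abs_excess_sub_excess_le u l _ _) (by linarith)) (by positivity)
  zero_outside := by
    filter_upwards [hu.zero_outside] with x hx hxΩ
    simp [_root_.excess, hx hxΩ, hl]

/-- The truncation inequality: replacing `u` by `(u - l)^+` only decreases
`|a - b|^(p-2) (a - b) (a^+ - b^+)`. -/
lemma abs_excess_sub_rpow_le {α : Type*} (u : α → ℝ) (l : ℝ) {p : ℝ} (hp : 1 < p) (x y : α) :
    |excess u l x - excess u l y| ^ p ≤
      |u x - u y| ^ (p - 2) * (u x - u y) * (excess u l x - excess u l y) := by
  have h1 := abs_excess_sub_excess_le u l x y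
  -- both differences have the same sign
  have h2 : (u x - u y) * (excess u l x - excess u l y) =
      |u x - u y| * |excess u l x - excess u l y| := by
    rw [← abs_mul, abs_of_nonneg]
    unfold excess
    rcases le_total (u x) (u y) with h | h
    · exact mul_nonneg_of_nonpos_of_nonpos (by linarith)
        (sub_nonpos.2 (max_le_max_right _ (by linarith)))
    · exact mul_nonneg (by linarith) (sub_nonneg.2 (max_le_max_right _ (by linarith)))
  rw [mul_assoc, h2]
  rcases (abs_nonneg (excess u l x - excess u l y)).eq_or_lt with h0 | h0
  · rw [← h0, Real.zero_rpow (by linarith)]; simp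
  · have h3 : 0 < |u x - u y| := h0.trans_le h1
    calc |excess u l x - excess u l y| ^ p
        = |excess u l x - excess u l y| ^ (p - 1) * |excess u l x - excess u l y| := by
          rw [← Real.rpow_add_one h0.ne']; congr 1; ring
      _ ≤ |u x - u y| ^ (p - 1) * |excess u l x - excess u l y| := by gcongr
      _ = _ := by
          rw [← mul_assoc, ← Real.rpow_add_one h3.ne']; congr 2; ring

lemma abs_form_integrand_le {α : Type*} (u : α → ℝ) (l p : ℝ) (x y : α) :
    |u x - u y| ^ (p - 2) * (u x - u y) * (excess u l x - excess u l y) ≤ |u x - u y| ^ p := by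
  rcases (abs_nonneg (u x - u y)).eq_or_lt with h0 | h0
  · rw [abs_eq_zero.1 h0.symm]; simp; positivity
  · calc |u x - u y| ^ (p - 2) * (u x - u y) * (excess u l x - excess u l y)
        ≤ |u x - u y| ^ (p - 2) * (|u x - u y| * |u x - u y|) := by
          rw [mul_assoc]
          refine mul_le_mul_of_nonneg_left ?_ (by positivity)
          refine (le_abs_self _).trans ?_
          rw [abs_mul]
          exact mul_le_mul_of_nonneg_left (abs_excess_sub_excess_le u l x y) (abs_nonneg _)
      _ = |u x - u y| ^ p := by
          rw [← sq, ← Real.rpow_natCast, ← Real.rpow_add h0]; congr 1; simp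

/-- The energy of `(u - l)^+` is at most `∫_Ω |f(x,u)| (u - l)^+`. -/
lemma IsWeakSolution.gagliardoEnergy_excess_le {N : ℕ} {s p : ℝ} (hp : 1 < p)
    {Ω : Set (EuclideanSpace ℝ (Fin N))} {f : EuclideanSpace ℝ (Fin N) → ℝ → ℝ}
    {u : EuclideanSpace ℝ (Fin N) → ℝ} (hu : IsWeakSolution s p Ω f u) {l : ℝ} (hl : 0 ≤ l) :
    gagliardoEnergy s p (excess u l) ≤ ∫⁻ x in Ω, ENNReal.ofReal (|f x (u x)| * excess u l x) := by
  have hum : AEMeasurable u := hu.mem.memLp.1.aemeasurable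
  have hw := hu.mem.excess hp hl
  have hwm : AEMeasurable (excess u l) := hw.memLp.1.aemeasurable
  set F : EuclideanSpace ℝ (Fin N) × EuclideanSpace ℝ (Fin N) → ℝ := fun z =>
    |u z.1 - u z.2| ^ (p - 2) * (u z.1 - u z.2) * (excess u l z.1 - excess u l z.2) /
      ‖z.1 - z.2‖ ^ (N + s * p) with hF
  have hlow : ∀ z, |excess u l z.1 - excess u l z.2| ^ p / ‖z.1 - z.2‖ ^ (N + s * p) ≤ F z :=
    fun z => by
      simp only [hF]; gcongr; exact abs_excess_sub_rpow_le u l hp _ _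
  have hF0 : ∀ z, 0 ≤ F z := fun z => le_trans (by positivity) (hlow z)
  have hFm : AEMeasurable F volume := by
    have h1 : AEMeasurable (fun z : EuclideanSpace ℝ (Fin N) × EuclideanSpace ℝ (Fin N) => u z.1)
        volume := hum.comp_fst
    have h2 : AEMeasurable (fun z : EuclideanSpace ℝ (Fin N) × EuclideanSpace ℝ (Fin N) => u z.2)
        volume := hum.comp_snd
    have h3 : AEMeasurable (fun z : EuclideanSpace ℝ (Fin N) × EuclideanSpace ℝ (Fin N) =>
        excess u l z.1) volume := hwm.comp_fst
    have h4 : AEMeasurable (fun z : EuclideanSpace ℝ (Fin N) × EuclideanSpace ℝ (Fin N) =>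
        excess u l z.2) volume := hwm.comp_snd
    fun_prop
  have hFint : Integrable F volume := by
    refine ⟨hFm.aestronglyMeasurable, lt_of_le_of_lt (lintegral_mono fun z => ?_)
      hu.mem.energy_lt_top⟩
    rw [Real.enorm_eq_ofReal_abs, abs_of_nonneg (hF0 z)]
    refine ENNReal.ofReal_le_ofReal ?_
    simp only [hF]; gcongr; exact abs_form_integrand_le u l p _ _
  calc gagliardoEnergy s p (excess u l) ≤ ∫⁻ z, ENNReal.ofReal (F z) :=
        lintegral_mono fun z => ENNReal.ofReal_le_ofReal (hlow z)
    _ = ENNReal.ofReal (fracPLaplaceForm s p u (excess u l)) :=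
        (ofReal_integral_eq_lintegral_ofReal hFint (Filter.Eventually.of_forall hF0)).symm
    _ = ENNReal.ofReal (∫ x in Ω, f x (u x) * excess u l x) := by rw [hu.eq _ hw]
    _ ≤ ‖∫ x in Ω, f x (u x) * excess u l x‖ₑ := by
        rw [Real.enorm_eq_ofReal_abs]; exact ENNReal.ofReal_le_ofReal (le_abs_self _)
    _ ≤ ∫⁻ x in Ω, ‖f x (u x) * excess u l x‖ₑ := enorm_integral_le_lintegral_enorm _
    _ = _ := by
        refine lintegral_congr fun x => ?_
        rw [Real.enorm_eq_ofReal_abs, abs_mul, abs_of_nonneg (excess_nonneg u l x)]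

/-- The class of problems is invariant under `u ↦ -u`. -/
lemma IsWeakSolution.neg {N : ℕ} {s p : ℝ} {Ω : Set (EuclideanSpace ℝ (Fin N))}
    {f : EuclideanSpace ℝ (Fin N) → ℝ → ℝ} {u : EuclideanSpace ℝ (Fin N) → ℝ}
    (hu : IsWeakSolution s p Ω f u) :
    IsWeakSolution s p Ω (fun x t => -f x (-t)) (fun x => -u x) where
  mem :=
    { memLp := hu.mem.memLp.neg
      energy_lt_top := by
        have : gagliardoEnergy s p (fun x => -u x) = gagliardoEnergy s p u := by
          unfold gagliardoEnergy
          refine lintegral_congr fun z => ?_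
          rw [neg_sub_neg, abs_sub_comm]
        rw [this]; exact hu.mem.energy_lt_top
      zero_outside := by
        filter_upwards [hu.mem.zero_outside] with x hx hxΩ
        rw [hx hxΩ, neg_zero] }
  dual := by
    obtain ⟨K, hK⟩ := hu.dual
    refine ⟨K, fun v hv => ?_⟩
    simp only [neg_neg, neg_mul, integral_neg, abs_neg]
    exact ⟨(hK v hv).1.neg, (hK v hv).2⟩
  eq := fun v hv => by
    simp only [neg_neg, neg_mul, integral_neg]
    rw [← hu.eq v hv, fracPLaplaceForm, fracPLaplaceForm, ← integral_neg]
    congr 1 with z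
    rw [neg_sub_neg, abs_sub_comm (u z.2)]
    ring

/-! ### The level estimate -/

/-- Hölder's inequality for three functions. -/
lemma lintegral_mul_mul_rpow_le {α : Type*} [MeasurableSpace α] {μ : Measure α}
    {F G H : α → ℝ≥0∞} (hF : AEMeasurable F μ) (hG : AEMeasurable G μ) (hH : AEMeasurable H μ)
    {a b c : ℝ} (ha : 0 ≤ a) (hb : 0 ≤ b) (hc : 0 ≤ c) (habc : a + b + c = 1) :
    ∫⁻ x, F x ^ a * G x ^ b * H x ^ c ∂μ ≤
      (∫⁻ x, F x ∂μ) ^ a * (∫⁻ x, G x ∂μ) ^ b * (∫⁻ x, H x ∂μ) ^ c := by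
  have := ENNReal.lintegral_prod_norm_pow_le (μ := μ) Finset.univ (f := ![F, G, H])
    (p := ![a, b, c]) (by intro i _; fin_cases i <;> assumption)
    (by simpa [Fin.sum_univ_three] using habc) (by intro i _; fin_cases i <;> assumption)
  simpa [Fin.prod_univ_three] using this

/-- Where `u > l`, the function `u` is at most `M / (l - k)` times its excess over the lower level
`k`, and that excess is at least `l - k`; this makes `|u|^(q-1) (u - l)^+` homogeneous of degree
`max p q` in the excesses. -/
lemma rpow_mul_excess_le {α : Type*} (u : α → ℝ) {k l M p q a : ℝ} (hk : 0 ≤ k) (hkl : k < l)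
    (hlM : l ≤ M) (hq : 1 ≤ q) (ha1 : a ≤ 1) (x : α) :
    |u x| ^ (q - 1) * excess u l x ≤
      (M / (l - k)) ^ (max p q - 1) * M ^ (-(max p q - q)) *
        (excess u l x ^ a * excess u k x ^ (max p q - a)) := by
  have hM : 0 < M := by linarith
  have hd : 0 < l - k := by linarith
  have hPq : q ≤ max p q := le_max_right _ _
  rcases le_or_gt (u x) l with h | h
  · have h0 : excess u l x = 0 := max_eq_right (by linarith)
    rw [h0, mul_zero]
    have := excess_nonneg u k x
    positivity
  have hl : excess u l x = u x - l := max_eq_left (by linarith)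
  have hke : excess u k x = u x - k := max_eq_left (by linarith)
  set P := max p q
  set v := u x with hv
  have hvl : 0 < v - l := by linarith
  have hvk : 0 < v - k := by linarith
  set Λ := M / (l - k) with hΛ
  have hΛ0 : 0 < Λ := by positivity
  have hvΛ : |v| ≤ Λ * (v - k) := by
    rw [abs_of_pos (by linarith), hΛ, div_mul_eq_mul_div, le_div_iff₀ hd]
    nlinarith [mul_nonneg (by linarith : 0 ≤ v - k) (by linarith : 0 ≤ M - l),
      mul_nonneg hk hvl.le]
  rw [hl, hke]
  calc |v| ^ (q - 1) * (v - l)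
      ≤ (Λ * (v - k)) ^ (q - 1) * ((v - l) ^ a * (v - k) ^ (1 - a)) := by
        have h1 : (v - l) ^ (1 - a) ≤ (v - k) ^ (1 - a) :=
          Real.rpow_le_rpow hvl.le (by linarith) (by linarith)
        have h2 : v - l ≤ (v - l) ^ a * (v - k) ^ (1 - a) :=
          calc v - l = (v - l) ^ a * (v - l) ^ (1 - a) := by
                rw [← Real.rpow_add hvl]; simp
            _ ≤ _ := by gcongr
        gcongr
    _ = Λ ^ (q - 1) * (v - l) ^ a * ((v - k) ^ (P - a) * (v - k) ^ (-(P - q))) := by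
        rw [Real.mul_rpow hΛ0.le hvk.le, ← Real.rpow_add hvk]
        have : (v - k) ^ (P - a + -(P - q)) = (v - k) ^ (q - 1) * (v - k) ^ (1 - a) := by
          rw [← Real.rpow_add hvk]; congr 1; ring
        rw [this]; ring
    _ ≤ Λ ^ (q - 1) * (v - l) ^ a * ((v - k) ^ (P - a) * (M / Λ) ^ (-(P - q))) := by
        have h1 : M / Λ = l - k := by rw [hΛ]; field_simp
        have h2 : (v - k) ^ (-(P - q)) ≤ (M / Λ) ^ (-(P - q)) := by
          rw [h1]
          exact Real.rpow_le_rpow_of_nonpos hd (by linarith) (by linarith)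
        gcongr
    _ = _ := by
        rw [Real.div_rpow hM.le hΛ0.le, Real.rpow_neg hΛ0.le, div_inv_eq_mul]
        have : Λ ^ (P - 1) = Λ ^ (q - 1) * Λ ^ (P - q) := by
          rw [← Real.rpow_add hΛ0]; congr 1; ring
        rw [this]; ring

lemma measurable_boundaryDist {N : ℕ} (Ω : Set (EuclideanSpace ℝ (Fin N))) :
    Measurable (boundaryDist Ω) :=
  (Metric.continuous_infDist_pt _).measurable

/-- A term `h |u|^(q-1) (u - l)^+` of the right-hand side, estimated by Hölder's inequality with the
factors `h ρ^(s a) ∈ L^r`, `((u - l)^+ / ρ^s)^a ∈ L^(p/a)` (by Hardy's inequality) and a power of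
`(u - k)^+ ∈ L^qmax`. -/
lemma exists_lintegral_weight_mul_excess_le {N : ℕ} (hN : 1 ≤ N) {s p : ℝ} (hs : 0 < s) (hp : 1 < p)
    {Ω : Set (EuclideanSpace ℝ (Fin N))} (hΩo : IsOpen Ω) (hΩb : Bornology.IsBounded Ω)
    (hΩL : HasLipschitzBoundary Ω) {q a r : ℝ} {h : EuclideanSpace ℝ (Fin N) → ℝ} (hq : 1 ≤ q)
    (hh0 : ∀ᵐ x ∂volume.restrict Ω, 0 ≤ h x) (hh : IsTildeWeight s p Ω q a r h)
    {qt qmax : ℝ} (hqt1 : 1 < qt) (hqteq : 1 / r + a / p + (max p q - a) / qt = 1)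
    (hqtmax : qt ≤ qmax) :
    ∃ B : ℝ, 0 < B ∧ ∀ (u : EuclideanSpace ℝ (Fin N) → ℝ) (k l M y : ℝ), MemSobolevZero s p Ω u →
      0 ≤ k → k < l → l ≤ M → 0 ≤ y →
      eLpNorm (excess u k) (ENNReal.ofReal qmax) (volume.restrict Ω) ≤ ENNReal.ofReal y →
      ∫⁻ x in Ω, ENNReal.ofReal (h x * |u x| ^ (q - 1) * excess u l x) ≤
        ENNReal.ofReal (B * (M / (l - k)) ^ (max p q - 1) * M ^ (-(max p q - q)) *
          gagliardoNorm s p (excess u l) ^ a * y ^ (max p q - a)) := by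
  obtain ⟨C₁, hC₁, H₁⟩ := exists_hardy_inequality hN hs hp hΩo hΩb hΩL
  have : IsFiniteMeasure (volume.restrict Ω) := ⟨by simpa using hΩb.measure_lt_top⟩
  have hqt0 : 0 < qt := by linarith
  obtain ⟨C₂, hC₂, H₂⟩ := exists_eLpNorm_le_mul_eLpNorm (μ := volume.restrict Ω) hqt0 hqtmax
  set W := (eLpNorm (fun x => h x * boundaryDist Ω x ^ (s * a)) (ENNReal.ofReal r)
    (volume.restrict Ω)).toReal with hW
  have hW' : ENNReal.ofReal W = eLpNorm (fun x => h x * boundaryDist Ω x ^ (s * a))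
      (ENNReal.ofReal r) (volume.restrict Ω) := ENNReal.ofReal_toReal hh.memLp.2.ne
  have hW0 : 0 ≤ W := ENNReal.toReal_nonneg
  have hr0 : 0 < r := by linarith [hh.one_lt_r]
  have hp0 : 0 < p := by linarith
  have ha0 := hh.a_nonneg
  have ha1 := hh.a_le_one
  have hPa : 0 < max p q - a := by have := le_max_left p q; linarith
  refine ⟨(W + 1) * C₁ ^ (a / p) * C₂ ^ (max p q - a), by positivity, ?_⟩
  intro u k l M y hu hk hkl hlM hy hyk
  have hl0 : 0 ≤ l := by linarith
  have hM : 0 < M := by linarith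
  have hd : 0 < l - k := by linarith
  have hwl := hu.excess hp hl0
  have hwk := hu.excess hp hk
  have hwlm : AEMeasurable (excess u l) (volume.restrict Ω) := hwl.memLp.1.aemeasurable.restrict
  have hwkm : AEMeasurable (excess u k) (volume.restrict Ω) := hwk.memLp.1.aemeasurable.restrict
  have hρm : AEMeasurable (boundaryDist Ω) (volume.restrict Ω) :=
    (measurable_boundaryDist Ω).aemeasurable
  have hhm := hh.aemeasurable
  set P := max p q with hP
  set n := gagliardoNorm s p (excess u l)
  have hn : 0 ≤ n := gagliardoNorm_nonneg _ _ _
  set A := (M / (l - k)) ^ (P - 1) * M ^ (-(P - q)) with hA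
  have hA0 : 0 ≤ A := by positivity
  set F₁ := fun x => ENNReal.ofReal (|h x * boundaryDist Ω x ^ (s * a)| ^ r) with hF₁
  set F₂ := fun x => ENNReal.ofReal ((|excess u l x| / boundaryDist Ω x ^ s) ^ p) with hF₂
  set F₃ := fun x => ENNReal.ofReal (|excess u k x| ^ qt) with hF₃
  have hpt : ∀ᵐ x ∂volume.restrict Ω, ENNReal.ofReal (h x * |u x| ^ (q - 1) * excess u l x) ≤
      ENNReal.ofReal A * (F₁ x ^ (1 / r) * F₂ x ^ (a / p) * F₃ x ^ ((P - a) / qt)) := by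
    filter_upwards [hh0, ae_restrict_mem hΩo.measurableSet] with x hx hxΩ
    obtain ⟨hρ, -⟩ := exists_mem_frontier_boundaryDist_eq hN hΩo hΩb hxΩ
    have hl1 := excess_nonneg u l x
    have hk1 := excess_nonneg u k x
    simp only [hF₁, hF₂, hF₃]
    rw [ENNReal.ofReal_rpow_of_nonneg (by positivity) (by positivity),
      ENNReal.ofReal_rpow_of_nonneg (by positivity) (by positivity),
      ENNReal.ofReal_rpow_of_nonneg (by positivity) (by positivity),
      ← ENNReal.ofReal_mul (by positivity), ← ENNReal.ofReal_mul (by positivity),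
      ← ENNReal.ofReal_mul hA0, ← Real.rpow_mul (by positivity), ← Real.rpow_mul (by positivity),
      ← Real.rpow_mul (by positivity), mul_one_div_cancel hr0.ne', Real.rpow_one,
      mul_div_cancel₀ _ hp0.ne', mul_div_cancel₀ _ hqt0.ne',
      abs_of_nonneg (mul_nonneg hx (Real.rpow_nonneg hρ.le (s * a))), abs_of_nonneg hl1,
      abs_of_nonneg hk1, Real.div_rpow hl1 (by positivity),
      ← Real.rpow_mul hρ.le]
    refine ENNReal.ofReal_le_ofReal ?_
    calc h x * |u x| ^ (q - 1) * excess u l x = h x * (|u x| ^ (q - 1) * excess u l x) := by ring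
      _ ≤ h x * (A * (excess u l x ^ a * excess u k x ^ (P - a))) := by
          exact mul_le_mul_of_nonneg_left (rpow_mul_excess_le u hk hkl hlM hq ha1 x) hx
      _ = _ := by
          have : 0 < boundaryDist Ω x ^ (s * a) := by positivity
          field_simp
  have h1 : (∫⁻ x in Ω, F₁ x) ^ (1 / r) = ENNReal.ofReal W := by
    rw [hW', eLpNorm_ofReal_eq hr0]
  have h2 : (∫⁻ x in Ω, F₂ x) ^ (a / p) ≤ ENNReal.ofReal (C₁ ^ (a / p) * n ^ a) := by
    calc (∫⁻ x in Ω, F₂ x) ^ (a / p)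
        ≤ (ENNReal.ofReal C₁ * ENNReal.ofReal (n ^ p)) ^ (a / p) := by
          rw [ofReal_gagliardoNorm_rpow hp hwl.energy_lt_top]
          exact ENNReal.rpow_le_rpow (H₁ _ hwl) (by positivity)
      _ = _ := by
          rw [← ENNReal.ofReal_mul hC₁.le, ENNReal.ofReal_rpow_of_nonneg (by positivity)
            (by positivity), Real.mul_rpow hC₁.le (by positivity), ← Real.rpow_mul hn,
            mul_div_cancel₀ _ hp0.ne']
  have h3 : (∫⁻ x in Ω, F₃ x) ^ ((P - a) / qt) ≤
      ENNReal.ofReal (C₂ ^ (P - a) * y ^ (P - a)) := by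
    simp only [hF₃]
    rw [lintegral_ofReal_rpow_eq hqt0, ← ENNReal.rpow_mul, mul_div_cancel₀ _ hqt0.ne',
      ← Real.mul_rpow hC₂.le hy, ← ENNReal.ofReal_rpow_of_nonneg (by positivity) hPa.le,
      ENNReal.ofReal_mul hC₂.le]
    refine ENNReal.rpow_le_rpow ((H₂ _ hwk.memLp.1.restrict).trans ?_) hPa.le
    gcongr
  calc ∫⁻ x in Ω, ENNReal.ofReal (h x * |u x| ^ (q - 1) * excess u l x)
      ≤ ∫⁻ x in Ω, ENNReal.ofReal A * (F₁ x ^ (1 / r) * F₂ x ^ (a / p) * F₃ x ^ ((P - a) / qt)) :=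
        lintegral_mono_ae hpt
    _ ≤ ENNReal.ofReal A * ((∫⁻ x in Ω, F₁ x) ^ (1 / r) * (∫⁻ x in Ω, F₂ x) ^ (a / p) *
          (∫⁻ x in Ω, F₃ x) ^ ((P - a) / qt)) := by
        rw [lintegral_const_mul' _ _ ENNReal.ofReal_ne_top]
        gcongr
        exact lintegral_mul_mul_rpow_le (by fun_prop) (by fun_prop) (by fun_prop) (by positivity)
          (by positivity) (by positivity) hqteq
    _ ≤ ENNReal.ofReal A * (ENNReal.ofReal (W + 1) * ENNReal.ofReal (C₁ ^ (a / p) * n ^ a) *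
          ENNReal.ofReal (C₂ ^ (P - a) * y ^ (P - a))) := by
        rw [h1]
        gcongr
        linarith
    _ = _ := by
        rw [← ENNReal.ofReal_mul (by positivity), ← ENNReal.ofReal_mul (by positivity),
          ← ENNReal.ofReal_mul hA0]
        congr 1
        rw [hA]; ring

/-- The gain of a De Giorgi step: `(u - l)^+` lives on `{u > l}`, whose measure Chebyshev's
inequality controls by the excess over the lower level `k`. -/
lemma eLpNorm_excess_le {α : Type*} [MeasurableSpace α] {μ : Measure α} {u : α → ℝ}
    (hu : AEMeasurable u μ) {k l M y q κ : ℝ} (hkl : k < l) (hM : 0 < M) (hy : 0 ≤ y) (hq : 0 < q)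
    (hqκ : q < κ) (hyk : eLpNorm (excess u k) (ENNReal.ofReal q) μ ≤ ENNReal.ofReal y) :
    eLpNorm (excess u l) (ENNReal.ofReal q) μ ≤
      eLpNorm (excess u l) (ENNReal.ofReal κ) μ *
        ENNReal.ofReal ((M / (l - k) * y / M) ^ (1 - q / κ)) := by
  have hd : 0 < l - k := by linarith
  have hkm : AEStronglyMeasurable (excess u k) μ :=
    AEMeasurable.aestronglyMeasurable (by unfold excess; fun_prop)
  have hlm : AEStronglyMeasurable (excess u l) μ :=
    AEMeasurable.aestronglyMeasurable (by unfold excess; fun_prop)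
  set A : Set α := {x | ENNReal.ofReal (l - k) ≤ ‖excess u k x‖ₑ} with hA
  have hsupp : Function.support (excess u l) ⊆ A := by
    intro x hx
    have h1 : l < u x := by
      by_contra hcon
      exact hx (max_eq_right (by linarith [not_lt.1 hcon]))
    have h2 : excess u k x = u x - k := max_eq_left (by linarith)
    show ENNReal.ofReal (l - k) ≤ ‖excess u k x‖ₑ
    rw [h2, Real.enorm_eq_ofReal_abs, abs_of_pos (by linarith)]
    exact ENNReal.ofReal_le_ofReal (by linarith)
  have hμA : μ A ≤ ENNReal.ofReal ((M / (l - k) * y / M) ^ q) := by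
    have h1 := meas_ge_le_mul_pow_eLpNorm_enorm μ (p := ENNReal.ofReal q) (by simpa using hq)
      ENNReal.ofReal_ne_top hkm (ε := ENNReal.ofReal (l - k)) (by simpa using hd) (by simp)
    rw [ENNReal.toReal_ofReal hq.le] at h1
    refine h1.trans ?_
    calc _ ≤ (ENNReal.ofReal (l - k))⁻¹ ^ q * ENNReal.ofReal y ^ q := by gcongr
      _ = _ := by
        rw [← ENNReal.mul_rpow_of_nonneg _ _ hq.le, ← ENNReal.ofReal_inv_of_pos hd,
          ← ENNReal.ofReal_mul (by positivity), ENNReal.ofReal_rpow_of_nonneg (by positivity) hq.le]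
        congr 2
        field_simp
  have hε : 0 ≤ 1 / q - 1 / κ := sub_nonneg.2 (one_div_le_one_div_of_le hq hqκ.le)
  have h2 := eLpNorm_le_eLpNorm_mul_rpow_measure_univ (ENNReal.ofReal_le_ofReal hqκ.le)
    (hlm.mono_measure (Measure.restrict_le_self (s := A)))
  rw [eLpNorm_restrict_eq_of_support_subset hsupp, eLpNorm_restrict_eq_of_support_subset hsupp,
    Measure.restrict_apply_univ, ENNReal.toReal_ofReal hq.le,
    ENNReal.toReal_ofReal (hq.trans hqκ).le] at h2
  refine h2.trans ?_
  gcongr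
  calc μ A ^ (1 / q - 1 / κ) ≤ ENNReal.ofReal ((M / (l - k) * y / M) ^ q) ^ (1 / q - 1 / κ) := by
        gcongr
    _ = _ := by
        rw [ENNReal.ofReal_rpow_of_nonneg (by positivity) hε, ← Real.rpow_mul (by positivity)]
        congr 2
        field_simp

/-- The recursive inequality of the De Giorgi iteration. For consecutive levels `k < l` the excesses
satisfy, for one of the indices `i`,
`|(u - l)^+|_qmax ≤ C (M / (l - k))^τ M^(-b i) |(u - k)^+|_qmax^(1 + e i)`,
where the exponents `e i` are positive. The constants depend neither on `u` nor on `f`. -/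
lemma exists_level_estimate {N : ℕ} (hN : 1 ≤ N) {s p : ℝ} (hs : 0 < s) (hp : 1 < p)
    {Ω : Set (EuclideanSpace ℝ (Fin N))} (hΩo : IsOpen Ω) (hΩb : Bornology.IsBounded Ω)
    (hΩL : HasLipschitzBoundary Ω)
    {m : ℕ} (hm : 1 ≤ m) {q a r : Fin m → ℝ} {h : Fin m → EuclideanSpace ℝ (Fin N) → ℝ}
    (hq1 : ∀ i, 1 ≤ q i) (hh0 : ∀ i, ∀ᵐ x ∂volume.restrict Ω, 0 ≤ h i x)
    (hh : ∀ i, IsTildeWeight s p Ω (q i) (a i) (r i) (h i))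
    {qt : Fin m → ℝ} (hqt1 : ∀ i, 1 < qt i)
    (hqteq : ∀ i, 1 / r i + a i / p + (max p (q i) - a i) / qt i = 1)
    {qmax : ℝ} (hqmax0 : 0 < qmax) (hqmax : ∀ i, qt i ≤ qmax)
    (hqcrit : ENNReal.ofReal qmax < criticalExponent N s p) :
    ∃ (C τ ε : ℝ) (b e : Fin m → ℝ), 0 < C ∧ 0 < τ ∧ 0 < ε ∧ (∀ i, 0 < b i) ∧ (∀ i, ε ≤ e i) ∧
      ∀ (f : EuclideanSpace ℝ (Fin N) → ℝ → ℝ) (u : EuclideanSpace ℝ (Fin N) → ℝ),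
      (∀ᵐ x ∂volume.restrict Ω, ∀ t : ℝ, |f x t| ≤ ∑ i, h i x * |t| ^ (q i - 1)) →
      IsWeakSolution s p Ω f u →
      ∀ k l M y : ℝ, 0 ≤ k → k < l → l ≤ M → 0 ≤ y →
      eLpNorm (excess u k) (ENNReal.ofReal qmax) (volume.restrict Ω) ≤ ENNReal.ofReal y →
      ∃ i, eLpNorm (excess u l) (ENNReal.ofReal qmax) (volume.restrict Ω) ≤
        ENNReal.ofReal (C * (M / (l - k)) ^ τ * M ^ (-b i) * y ^ (1 + e i)) := by
  obtain ⟨κ', hκ1, hκ2⟩ := ENNReal.lt_iff_exists_nnreal_btwn.1 hqcrit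
  obtain ⟨κ, hκ⟩ : ∃ κ : ℝ, κ = κ' := ⟨_, rfl⟩
  have hκe : (κ' : ℝ≥0∞) = ENNReal.ofReal κ := by rw [hκ, ENNReal.ofReal_coe_nnreal]
  rw [hκe] at hκ1 hκ2
  have hqκ : qmax < κ := (ENNReal.ofReal_lt_ofReal_iff_of_nonneg hqmax0.le).1 hκ1
  have hκ0 : 0 < κ := hqmax0.trans hqκ
  obtain ⟨Cs, hCs, HS⟩ := exists_sobolev_inequality hN hs hp hΩo hΩb hΩL hκ0 hκ2
  choose B hB HB using fun i => exists_lintegral_weight_mul_excess_le hN hs hp hΩo hΩb hΩL (hq1 i)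
    (hh0 i) (hh i) (hqt1 i) (hqteq i) (hqmax i)
  have hm0 : (0 : ℝ) < m := by exact_mod_cast hm
  set ε := 1 - qmax / κ with hε
  have hε0 : 0 < ε := by rw [hε, sub_pos, div_lt_one hκ0]; exact hqκ
  have hpa : ∀ i, 0 < p - a i := fun i => by linarith [(hh i).a_le_one]
  have hPp : ∀ i, p ≤ max p (q i) := fun i => le_max_left _ _
  have hPq : ∀ i, q i ≤ max p (q i) := fun i => le_max_right _ _
  have hτi : ∀ i, 0 ≤ (max p (q i) - 1) / (p - a i) := fun i =>
    div_nonneg (by linarith [hPp i]) (hpa i).le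
  have hCi : ∀ i, 0 < Cs * (m * B i) ^ (1 / (p - a i)) := fun i => by
    have := hB i; positivity
  refine ⟨∑ i, Cs * (m * B i) ^ (1 / (p - a i)), ∑ i, (max p (q i) - 1) / (p - a i) + ε, ε,
    fun i => ε + (max p (q i) - q i) / (p - a i), fun i => ε + (max p (q i) - p) / (p - a i),
    Finset.sum_pos (fun i _ => hCi i) ⟨⟨0, hm⟩, Finset.mem_univ _⟩,
    add_pos_of_nonneg_of_pos (Finset.sum_nonneg fun i _ => hτi i) hε0, hε0,
    fun i => add_pos_of_pos_of_nonneg hε0 (div_nonneg (by linarith [hPq i]) (hpa i).le),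
    fun i => le_add_of_nonneg_right (div_nonneg (by linarith [hPp i]) (hpa i).le), ?_⟩
  intro f u hf hu k l M y hk hkl hlM hy hyk
  have hl0 : 0 ≤ l := by linarith
  have hM : 0 < M := by linarith
  have hd : 0 < l - k := by linarith
  have hwl := hu.mem.excess hp hl0
  have hum : AEMeasurable u (volume.restrict Ω) := hu.mem.memLp.1.aemeasurable.restrict
  have hwlm : AEMeasurable (excess u l) (volume.restrict Ω) := hwl.memLp.1.aemeasurable.restrict
  have hhm := fun i => (hh i).aemeasurable
  have hn := gagliardoNorm_nonneg s p (excess u l)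
  set n := gagliardoNorm s p (excess u l) with hndef
  set Λ := M / (l - k) with hΛ
  have hΛ1 : 1 ≤ Λ := by rw [hΛ, one_le_div hd]; linarith
  have hΛ0 : 0 < Λ := by linarith
  set term : Fin m → ℝ := fun i => B i * Λ ^ (max p (q i) - 1) * M ^ (-(max p (q i) - q i)) *
    n ^ a i * y ^ (max p (q i) - a i) with hterm
  have hterm0 : ∀ i, 0 ≤ term i := fun i => by have := hB i; positivity
  have hsum : n ^ p ≤ ∑ i, term i := by
    rw [← ENNReal.ofReal_le_ofReal_iff (Finset.sum_nonneg fun i _ => hterm0 i),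
      ofReal_gagliardoNorm_rpow hp hwl.energy_lt_top]
    calc gagliardoEnergy s p (excess u l)
        ≤ ∫⁻ x in Ω, ENNReal.ofReal (|f x (u x)| * excess u l x) :=
          hu.gagliardoEnergy_excess_le hp hl0
      _ ≤ ∫⁻ x in Ω, ∑ i, ENNReal.ofReal (h i x * |u x| ^ (q i - 1) * excess u l x) := by
          refine lintegral_mono_ae ?_
          filter_upwards [hf, ae_all_iff.2 hh0] with x hx hx0
          have hw0 := excess_nonneg u l x
          rw [← ENNReal.ofReal_sum_of_nonneg fun i _ => by have := hx0 i; positivity,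
            ← Finset.sum_mul]
          gcongr
          exact hx (u x)
      _ = ∑ i, ∫⁻ x in Ω, ENNReal.ofReal (h i x * |u x| ^ (q i - 1) * excess u l x) :=
          lintegral_finsetSum' _ fun i _ => by have := hhm i; fun_prop
      _ ≤ ∑ i, ENNReal.ofReal (term i) :=
          Finset.sum_le_sum fun i _ => HB i u k l M y hu.mem hk hkl hlM hy hyk
      _ = _ := (ENNReal.ofReal_sum_of_nonneg fun i _ => hterm0 i).symm
  -- the largest of the `m` terms is at least the average
  obtain ⟨i, -, hi⟩ : ∃ i ∈ Finset.univ, n ^ p / m ≤ term i := by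
    refine Finset.exists_le_of_sum_le ⟨⟨0, hm⟩, Finset.mem_univ _⟩ ?_
    rw [Finset.sum_const, Finset.card_univ, Fintype.card_fin, nsmul_eq_mul,
      mul_div_cancel₀ _ hm0.ne']
    exact hsum
  have hpai := hpa i
  have hBi := hB i
  set P := max p (q i) with hP
  have hnle : n ≤ (m * B i) ^ (1 / (p - a i)) * Λ ^ ((P - 1) / (p - a i)) *
      M ^ (-((P - q i) / (p - a i))) * y ^ (1 + (P - p) / (p - a i)) := by
    have h1 : n ^ (p - a i) ≤ m * B i * Λ ^ (P - 1) * M ^ (-(P - q i)) * y ^ (P - a i) := by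
      rcases hn.eq_or_lt with h0 | h0
      · rw [← h0, Real.zero_rpow hpai.ne']; positivity
      · rw [Real.rpow_sub h0, div_le_iff₀ (by positivity)]
        rw [div_le_iff₀ hm0] at hi
        calc n ^ p ≤ term i * m := hi
          _ = _ := by simp only [hterm]; ring
    have h2 := Real.rpow_le_rpow (by positivity) h1 (by positivity : 0 ≤ 1 / (p - a i))
    rw [← Real.rpow_mul hn, mul_one_div_cancel hpai.ne', Real.rpow_one,
      Real.mul_rpow (by positivity) (by positivity), Real.mul_rpow (by positivity) (by positivity),
      Real.mul_rpow (by positivity) (by positivity), ← Real.rpow_mul hΛ0.le,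
      ← Real.rpow_mul hM.le, ← Real.rpow_mul hy] at h2
    convert h2 using 3
    · congr 1; ring_nf
    · congr 1; ring
    · field_simp; ring
  have hPpi : 0 ≤ (P - p) / (p - a i) := div_nonneg (by linarith [hPp i]) hpai.le
  refine ⟨i, ?_⟩
  calc eLpNorm (excess u l) (ENNReal.ofReal qmax) (volume.restrict Ω)
      ≤ eLpNorm (excess u l) (ENNReal.ofReal κ) (volume.restrict Ω) *
          ENNReal.ofReal ((Λ * y / M) ^ ε) := eLpNorm_excess_le hum hkl hM hy hqmax0 hqκ hyk
    _ ≤ ENNReal.ofReal (Cs * n) * ENNReal.ofReal ((Λ * y / M) ^ ε) := by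
        gcongr; exact HS _ hwl
    _ = ENNReal.ofReal (Cs * n * (Λ * y / M) ^ ε) := (ENNReal.ofReal_mul (by positivity)).symm
    _ ≤ _ := by
        refine ENNReal.ofReal_le_ofReal ?_
        calc Cs * n * (Λ * y / M) ^ ε
            ≤ Cs * ((m * B i) ^ (1 / (p - a i)) * Λ ^ ((P - 1) / (p - a i)) *
                M ^ (-((P - q i) / (p - a i))) * y ^ (1 + (P - p) / (p - a i))) *
                (Λ * y / M) ^ ε := by gcongr
          _ = (Cs * (m * B i) ^ (1 / (p - a i))) * Λ ^ ((P - 1) / (p - a i) + ε) *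
                M ^ (-(ε + (P - q i) / (p - a i))) * y ^ (1 + (ε + (P - p) / (p - a i))) := by
              have e1 : -(ε + (P - q i) / (p - a i)) = -((P - q i) / (p - a i)) + -ε := by ring
              have e2 : 1 + (ε + (P - p) / (p - a i)) = (1 + (P - p) / (p - a i)) + ε := by ring
              rw [e1, e2, Real.rpow_add hΛ0, Real.rpow_add hM,
                Real.rpow_add_of_nonneg hy (by positivity) hε0.le, Real.rpow_neg hM.le ε,
                Real.div_rpow (by positivity) hM.le, Real.mul_rpow hΛ0.le hy]
              ring
          _ ≤ _ := by
              have hC := Finset.single_le_sum (f := fun i => Cs * (m * B i) ^ (1 / (p - a i)))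
                (fun j _ => (hCi j).le) (Finset.mem_univ i)
              have hτ := Finset.single_le_sum (f := fun i => (max p (q i) - 1) / (p - a i))
                (fun j _ => hτi j) (Finset.mem_univ i)
              have hsum0 := (hCi i).le.trans hC
              gcongr

/-! ### De Giorgi iteration -/

/-- One step of the induction showing geometric decay: the ratio `2^(-τ/ε)` is chosen so that the
superlinear gain `ratio^(n ε)` cancels the loss `2^(n τ)`. -/
lemma deGiorgi_step {C τ ε b e M Y : ℝ} (hC : 0 < C) (hε : 0 < ε) (he : ε ≤ e) (hτ : 0 < τ)
    (hM : 0 < M) (hY : 0 ≤ Y)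
    (hMY : C * 2 ^ τ * ((2 : ℝ) ^ (-τ / ε))⁻¹ * Y ^ e ≤ M ^ b) (n : ℕ) :
    C * ((2 : ℝ) ^ (n + 1)) ^ τ * M ^ (-b) * (Y * ((2 : ℝ) ^ (-τ / ε)) ^ n) ^ (1 + e) ≤
      Y * ((2 : ℝ) ^ (-τ / ε)) ^ (n + 1) := by
  set η := (2 : ℝ) ^ (-τ / ε) with hη
  have hη0 : 0 < η := by positivity
  have hη1 : η ≤ 1 := Real.rpow_le_one_of_one_le_of_nonpos one_le_two
    (div_nonpos_of_nonpos_of_nonneg (by linarith) hε.le)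
  have hηε : η ^ ε = ((2 : ℝ) ^ τ)⁻¹ := by
    rw [hη, ← Real.rpow_mul zero_le_two, div_mul_cancel₀ _ hε.ne', Real.rpow_neg zero_le_two]
  have h1 : ((2 : ℝ) ^ n) ^ τ * (η ^ n) ^ e ≤ 1 := by
    calc ((2 : ℝ) ^ n) ^ τ * (η ^ n) ^ e ≤ ((2 : ℝ) ^ n) ^ τ * (η ^ n) ^ ε := by
          gcongr ?_ * ?_
          exact Real.rpow_le_rpow_of_exponent_ge (by positivity) (pow_le_one₀ hη0.le hη1) he
      _ = 1 := by
          rw [← Real.rpow_pow_comm zero_le_two τ n, ← Real.rpow_pow_comm hη0.le ε n, hηε, ← mul_pow,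
            mul_inv_cancel₀ (by positivity), one_pow]
  have h2 : C * 2 ^ τ * Y ^ e * M ^ (-b) ≤ η := by
    rw [Real.rpow_neg hM.le, ← div_eq_mul_inv, div_le_iff₀ (by positivity)]
    calc C * 2 ^ τ * Y ^ e = η * (C * 2 ^ τ * η⁻¹ * Y ^ e) := by field_simp
      _ ≤ _ := by gcongr
  have h3 : (Y * η ^ n) ^ (1 + e) = (Y * η ^ n) * (Y ^ e * (η ^ n) ^ e) := by
    rw [Real.rpow_add_of_nonneg (by positivity) zero_le_one (by linarith), Real.rpow_one,
      Real.mul_rpow hY (by positivity)]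
  rw [h3, pow_succ (2 : ℝ), Real.mul_rpow (by positivity) zero_le_two]
  calc C * (((2 : ℝ) ^ n) ^ τ * 2 ^ τ) * M ^ (-b) * (Y * η ^ n * (Y ^ e * (η ^ n) ^ e))
      = (C * 2 ^ τ * Y ^ e * M ^ (-b)) * (((2 : ℝ) ^ n) ^ τ * (η ^ n) ^ e) * (Y * η ^ n) := by ring
    _ ≤ η * 1 * (Y * η ^ n) := by gcongr
    _ = _ := by ring

/-- The iteration itself, for the levels `M (1 - 2^(-n))`. -/
lemma ae_le_of_level_estimate {α ι : Type*} [MeasurableSpace α] {μ : Measure α} {u : α → ℝ}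
    (hu : AEMeasurable u μ) {q C τ ε M Y : ℝ} {b e : ι → ℝ} (hq : 0 < q) (hC : 0 < C)
    (hτ : 0 < τ) (hε : 0 < ε) (he : ∀ i, ε ≤ e i) (hM : 0 < M) (hY : 0 ≤ Y)
    (hY0 : eLpNorm u (ENNReal.ofReal q) μ ≤ ENNReal.ofReal Y)
    (hMY : ∀ i, C * 2 ^ τ * ((2 : ℝ) ^ (-τ / ε))⁻¹ * Y ^ e i ≤ M ^ b i)
    (H : ∀ k l y : ℝ, 0 ≤ k → k < l → l ≤ M → 0 ≤ y →
      eLpNorm (excess u k) (ENNReal.ofReal q) μ ≤ ENNReal.ofReal y →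
      ∃ i, eLpNorm (excess u l) (ENNReal.ofReal q) μ ≤
        ENNReal.ofReal (C * (M / (l - k)) ^ τ * M ^ (-b i) * y ^ (1 + e i))) :
    ∀ᵐ x ∂μ, u x ≤ M := by
  set η := (2 : ℝ) ^ (-τ / ε) with hη
  have hη0 : 0 < η := by positivity
  have hη1 : η < 1 := Real.rpow_lt_one_of_one_lt_of_neg one_lt_two
    (div_neg_of_neg_of_pos (by linarith) hε)
  have hdecay : ∀ n : ℕ, eLpNorm (excess u (M * (1 - (2 ^ n)⁻¹))) (ENNReal.ofReal q) μ ≤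
      ENNReal.ofReal (Y * η ^ n) := by
    intro n
    induction n with
    | zero =>
      refine le_trans (eLpNorm_mono fun x => ?_) (hY0.trans (by simp))
      simpa using abs_excess_le u le_rfl x
    | succ n ih =>
      have h2n : (0 : ℝ) < (2 ^ n)⁻¹ := by positivity
      have h2n1 : ((2 : ℝ) ^ n)⁻¹ ≤ 1 := inv_le_one_of_one_le₀ (one_le_pow₀ one_le_two)
      have hhalf : ((2 : ℝ) ^ (n + 1))⁻¹ = (2 ^ n)⁻¹ / 2 := by rw [pow_succ, mul_inv]; ring
      obtain ⟨i, hi⟩ := H (M * (1 - (2 ^ n)⁻¹)) (M * (1 - (2 ^ (n + 1))⁻¹)) (Y * η ^ n)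
        (mul_nonneg hM.le (by linarith)) (by rw [hhalf]; gcongr; linarith)
        (mul_le_of_le_one_right hM.le (by rw [hhalf]; linarith)) (by positivity) ih
      refine hi.trans (ENNReal.ofReal_le_ofReal ?_)
      have hΛ : M / (M * (1 - (2 ^ (n + 1))⁻¹) - M * (1 - (2 ^ n)⁻¹)) = 2 ^ (n + 1) := by
        rw [pow_succ]; field_simp; ring
      rw [hΛ]
      exact deGiorgi_step hC hε (he i) hτ hM hY (hMY i) n
  have hlim : Filter.Tendsto (fun n : ℕ => ENNReal.ofReal (Y * η ^ n)) Filter.atTop (nhds 0) := by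
    have := (tendsto_pow_atTop_nhds_zero_of_lt_one hη0.le hη1).const_mul Y
    rw [mul_zero] at this
    simpa using ENNReal.tendsto_ofReal this
  have hzero : eLpNorm (excess u M) (ENNReal.ofReal q) μ = 0 := by
    refine le_antisymm (ge_of_tendsto' hlim fun n => le_trans (eLpNorm_mono fun x => ?_) (hdecay n))
      bot_le
    rw [Real.norm_of_nonneg (excess_nonneg _ _ _), Real.norm_of_nonneg (excess_nonneg _ _ _)]
    have : M * (1 - ((2 : ℝ) ^ n)⁻¹) ≤ M :=
      mul_le_of_le_one_right hM.le (by linarith [show (0 : ℝ) < (2 ^ n)⁻¹ by positivity])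
    exact max_le_max_right _ (by linarith)
  have hm : AEStronglyMeasurable (excess u M) μ :=
    AEMeasurable.aestronglyMeasurable (by unfold excess; fun_prop)
  rw [eLpNorm_eq_zero_iff hm (by simpa using hq)] at hzero
  filter_upwards [hzero] with x hx
  have h1 : u x - M ≤ excess u M x := le_max_left _ _
  have h2 : excess u M x = 0 := hx
  linarith

/-- Finitely many conditions `A Y^(e i) ≤ M^(b i)` hold as soon as `M` exceeds a multiple of
`max {Y^γ₁, Y^γ₂}`, where `γ₁` and `γ₂` are the extreme values of `e i / b i`. -/
lemma exists_threshold {ι : Type*} [Fintype ι] [Nonempty ι] {A : ℝ} (hA : 0 < A) {b e : ι → ℝ}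
    (hb : ∀ i, 0 < b i) (he : ∀ i, 0 < e i) :
    ∃ C γ₁ γ₂ : ℝ, 0 < C ∧ 0 < γ₁ ∧ 0 < γ₂ ∧ ∀ Y M : ℝ, 0 ≤ Y →
      C * max (Y ^ γ₁) (Y ^ γ₂) ≤ M → ∀ i, A * Y ^ e i ≤ M ^ b i := by
  obtain ⟨i₁, -, h₁⟩ := Finset.exists_min_image Finset.univ (fun i => e i / b i)
    Finset.univ_nonempty
  obtain ⟨i₂, -, h₂⟩ := Finset.exists_max_image Finset.univ (fun i => e i / b i)
    Finset.univ_nonempty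
  refine ⟨∑ i, A ^ (1 / b i), e i₁ / b i₁, e i₂ / b i₂,
    Finset.sum_pos (fun i _ => by positivity) Finset.univ_nonempty, div_pos (he _) (hb _),
    div_pos (he _) (hb _), fun Y M hY hM i => ?_⟩
  have hbi := hb i
  have hei := he i
  have hYi : Y ^ (e i / b i) ≤ max (Y ^ (e i₁ / b i₁)) (Y ^ (e i₂ / b i₂)) := by
    rcases hY.eq_or_lt with rfl | hY0
    · rw [Real.zero_rpow (div_pos hei hbi).ne']
      exact le_max_of_le_left (by positivity)
    rcases le_total 1 Y with h | h
    · exact le_max_of_le_right (Real.rpow_le_rpow_of_exponent_le h (h₂ i (Finset.mem_univ _)))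
    · exact le_max_of_le_left
        (Real.rpow_le_rpow_of_exponent_ge hY0 h (h₁ i (Finset.mem_univ _)))
  have hAi : A ^ (1 / b i) ≤ ∑ i, A ^ (1 / b i) :=
    Finset.single_le_sum (f := fun i => A ^ (1 / b i)) (fun j _ => by positivity)
      (Finset.mem_univ i)
  have hle : A ^ (1 / b i) * Y ^ (e i / b i) ≤ M := by
    refine le_trans ?_ hM
    gcongr
  calc A * Y ^ e i = (A ^ (1 / b i) * Y ^ (e i / b i)) ^ b i := by
        rw [Real.mul_rpow (by positivity) (by positivity), ← Real.rpow_mul hA.le,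
          ← Real.rpow_mul hY, one_div_mul_cancel hbi.ne', Real.rpow_one, div_mul_cancel₀ _ hbi.ne']
    _ ≤ _ := by gcongr

theorem theorem4p1 {N : ℕ} (hN : 1 ≤ N) (s p : ℝ) (hs0 : 0 < s) (hs1 : s < 1) (hp : 1 < p)
    (Ω : Set (EuclideanSpace ℝ (Fin N))) (hΩo : IsOpen Ω) (hΩb : Bornology.IsBounded Ω)
    (hΩL : HasLipschitzBoundary Ω)
    (f : EuclideanSpace ℝ (Fin N) → ℝ → ℝ) (hf : IsCaratheodory Ω f)
    (m : ℕ) (hm : 1 ≤ m) (q a r : Fin m → ℝ) (h : Fin m → EuclideanSpace ℝ (Fin N) → ℝ)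
    (hq1 : ∀ i, 1 ≤ q i) (hq : ∀ i, ENNReal.ofReal (q i) < criticalExponent N s p)
    (hh0 : ∀ i, ∀ᵐ x ∂volume.restrict Ω, 0 ≤ h i x)
    (hh : ∀ i, IsTildeWeight s p Ω (q i) (a i) (r i) (h i))
    (hfh : ∀ᵐ x ∂volume.restrict Ω, ∀ t : ℝ, |f x t| ≤ ∑ i, h i x * |t| ^ (q i - 1))
    (qt : Fin m → ℝ) (hqt1 : ∀ i, 1 < qt i)
    (hqt : ∀ i, ENNReal.ofReal (qt i) < criticalExponent N s p)
    (hqteq : ∀ i, 1 / r i + a i / p + (max p (q i) - a i) / qt i = 1)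
    (qmax : ℝ) (hqmax : IsGreatest (Set.range qt) qmax) :
    ∃ C γ₁ γ₂ : ℝ, 0 < C ∧ 0 < γ₁ ∧ 0 < γ₂ ∧
      ∀ u : EuclideanSpace ℝ (Fin N) → ℝ, IsWeakSolution s p Ω f u →
        MemLp u ⊤ (volume.restrict Ω) ∧
        (eLpNorm u ⊤ (volume.restrict Ω)).toReal ≤
          C * max ((eLpNorm u (ENNReal.ofReal qmax) (volume.restrict Ω)).toReal ^ γ₁)
            ((eLpNorm u (ENNReal.ofReal qmax) (volume.restrict Ω)).toReal ^ γ₂) := by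
  obtain ⟨⟨i₀, hi₀⟩, hub⟩ := hqmax
  have hqmax0 : 0 < qmax := by linarith [hqt1 i₀]
  have hqcrit : ENNReal.ofReal qmax < criticalExponent N s p := hi₀ ▸ hqt i₀
  have : Nonempty (Fin m) := ⟨i₀⟩
  obtain ⟨C₁, τ, ε, b, e, hC₁, hτ, hε, hb, he, H⟩ := exists_level_estimate hN hs0 hp hΩo hΩb hΩL hm
    hq1 hh0 hh hqt1 hqteq hqmax0 (fun i => hub ⟨i, rfl⟩) hqcrit
  obtain ⟨C, γ₁, γ₂, hC, hγ₁, hγ₂, hthr⟩ := exists_threshold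
    (A := C₁ * 2 ^ τ * ((2 : ℝ) ^ (-τ / ε))⁻¹) (by positivity) hb (fun i => hε.trans_le (he i))
  obtain ⟨Cs, -, HS⟩ := exists_sobolev_inequality hN hs0 hp hΩo hΩb hΩL hqmax0 hqcrit
  refine ⟨C, γ₁, γ₂, hC, hγ₁, hγ₂, fun u hu => ?_⟩
  set Y := (eLpNorm u (ENNReal.ofReal qmax) (volume.restrict Ω)).toReal with hY
  have hY0 : 0 ≤ Y := ENNReal.toReal_nonneg
  have hYu : eLpNorm u (ENNReal.ofReal qmax) (volume.restrict Ω) = ENNReal.ofReal Y :=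
    (ENNReal.ofReal_toReal (ne_top_of_le_ne_top ENNReal.ofReal_ne_top (HS u hu.mem))).symm
  have hum : AEMeasurable u (volume.restrict Ω) := hu.mem.memLp.1.aemeasurable.restrict
  have hfh' : ∀ᵐ x ∂volume.restrict Ω, ∀ t : ℝ, |-f x (-t)| ≤ ∑ i, h i x * |t| ^ (q i - 1) := by
    filter_upwards [hfh] with x hx t
    simpa using hx (-t)
  set M₀ := C * max (Y ^ γ₁) (Y ^ γ₂) with hM₀
  have hM₀0 : 0 ≤ M₀ := by positivity
  -- the iteration needs a positive level; when `Y = 0` the bound `M₀` is only reached as a limit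
  have hbound : ∀ M, M₀ < M → eLpNorm u ⊤ (volume.restrict Ω) ≤ ENNReal.ofReal M := by
    intro M hM
    have hM0 : 0 < M := hM₀0.trans_lt hM
    have hup := ae_le_of_level_estimate hum hqmax0 hC₁ hτ hε he hM0 hY0 hYu.le
      (hthr Y M hY0 hM.le) (fun k l y => H f u hfh hu k l M y)
    have hlow := ae_le_of_level_estimate hum.neg hqmax0 hC₁ hτ hε he hM0 hY0
      ((eLpNorm_neg u _ _).trans hYu).le
      (hthr Y M hY0 hM.le) (fun k l y => H _ _ hfh' hu.neg k l M y)
    rw [eLpNorm_exponent_top]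
    refine eLpNormEssSup_le_of_ae_bound ?_
    filter_upwards [hup, hlow] with x h1 h2
    have h3 : -u x ≤ M := h2
    exact abs_le.2 ⟨by linarith, h1⟩
  have hfin : eLpNorm u ⊤ (volume.restrict Ω) < ⊤ :=
    (hbound (M₀ + 1) (by linarith)).trans_lt ENNReal.ofReal_lt_top
  refine ⟨⟨hum.aestronglyMeasurable, hfin⟩, le_of_forall_gt_imp_ge_of_dense fun M hM => ?_⟩
  exact ENNReal.toReal_le_of_le_ofReal (hM₀0.trans hM.le) (hbound M hM)
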